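/- Let $G=(V,E)$ be a finite connected undirected graph with node costs $c\colon V\to\mathbb{R}_{\ge 0}$ and let $b\in\mathbb{R}_{\ge 0}$ be a budget. For distinct $s,t\in V$ let $\sigma_{s,t}$ be the number of shortest $s$--$t$ paths, and for $C\subseteq V$ let $\sigma_{s,t}(C)$ be the number of those that contain at least one node of $C$ (end nodes included). The group betweenness centrality of $C$ is $$\operatorname{GBC}(C)=\sum_{s,t\in V,\ s\ne t}\frac{\sigma_{s,t}(C)}{\sigma_{s,t}} .$$ The budgeted Maximum Betweenness Centrality (MBC) problem asks, given $(G,c,b)$, for a set $C\subseteq V$ with $\sum_{v\in C}c(v)\le b$ that maximizes $\operatorname{GBC}(C)$ among all such sets. Theorem. The budgeted MBC problem can be solved exactly in polynomial time on trees: there are an algorithm and a polynomial $p$ such that, on every instance $(G,c,b)$ in which $G$ is a tree with $n$ nodes, the algorithm halts after at most $p(n)$ steps and outputs an optimal set $C$. Moreover, the algorithm runs in time $O(n^7)$ if the tree is binary, that is, if it can be rooted so that every node has at most two children. Here an algorithm is a fixed program of a random access machine with cells for natural numbers and cells for real numbers, whose operations (constants that are natural numbers, reading and writing of cells with computed addresses,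 addition, subtraction, comparison) each take one step. There is no multiplication, so that the numbers computed in $t$ steps are only $O(t)$ bits longer than the data (for rational data, written over a common denominator). The input is given as $n$, the adjacency matrix of $G$, the costs and the budget. -/

import Mathlib

namespace MBC

/-! ## The maximum betweenness centrality problem -/

noncomputable section

/-- The set of shortest `s`-`t` paths of `G`. -/
def shortestPaths {V : Type*} (G : SimpleGraph V) (s t : V) : Set (G.Walk s t) :=
  {p | p.IsPath ∧ p.length = G.dist s t}

/-- `σ_{s,t}`: the number of shortest `s`-`t` paths. -/
def sigma {V : Type*} (G : SimpleGraph V) (s t : V) : ℕ :=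
  (shortestPaths G s t).ncard

/-- `σ_{s,t}(C)`: the number of shortest `s`-`t` paths that contain at least one node of `C`
(the end nodes `s` and `t` belong to the path). -/
def sigmaThrough {V : Type*} (G : SimpleGraph V) (C : Finset V) (s t : V) : ℕ :=
  {p ∈ shortestPaths G s t | ∃ v ∈ C, v ∈ p.support}.ncard

/-- The group betweenness centrality of `C`: the sum of `σ_{s,t}(C) / σ_{s,t}` over all ordered
pairs of distinct nodes. -/
def GBC {V : Type*} [Fintype V] [DecidableEq V] (G : SimpleGraph V) (C : Finset V) : ℝ :=
  ∑ s : V, ∑ t ∈ Finset.univ.filter (fun t => s ≠ t),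
    (sigmaThrough G C s t : ℝ) / (sigma G s t : ℝ)

/-- An instance of budgeted MBC on the nodes `0, …, n - 1`: a connected graph, nonnegative real
node costs and a nonnegative real budget. -/
structure Instance (n : ℕ) where
  graph : SimpleGraph (Fin n)
  connected : graph.Connected
  cost : Fin n → ℝ
  cost_nonneg : ∀ v, 0 ≤ cost v
  budget : ℝ
  budget_nonneg : 0 ≤ budget

/-- `C` respects the budget. -/
def Instance.IsFeasible {n : ℕ} (I : Instance n) (C : Finset (Fin n)) : Prop :=
  ∑ v ∈ C, I.cost v ≤ I.budget

/-- `C` is a solution of the instance: a node set within the budget of maximum group betweenness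
centrality. -/
def Instance.IsOptimal {n : ℕ} (I : Instance n) (C : Finset (Fin n)) : Prop :=
  I.IsFeasible C ∧ ∀ C' : Finset (Fin n), I.IsFeasible C' → GBC I.graph C' ≤ GBC I.graph C

/-- A graph (in the use below: a tree) can be rooted at some node `r` so that every node has at
most two children: the children of `r` are all its neighbours, and the children of any other node
are all its neighbours but one, its parent. -/
def IsBinary {V : Type*} (G : SimpleGraph V) : Prop :=
  ∃ r, (G.neighborSet r).ncard ≤ 2 ∧ ∀ v, v ≠ r → (G.neighborSet v).ncard ≤ 3

end

/-! ## The machine model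

A random access machine with natural number cells and real number cells, programmed by structured
programs. A program names finitely many arrays of either kind, with cells indexed by natural
numbers; a variable is an array of which only the cell `0` is used. The only arithmetic is addition
and subtraction, and real numbers can only be stored, added, subtracted and compared. Every
operation, memory access, comparison and constant counts as one step. There is no multiplication,
so that after `t` steps on rational data (written over a common denominator) the numbers in memory
have only `O(t)` bits more than the data. -/

/-- The memory: `M.nat a i` and `M.real a i` are the cells `i` of the arrays number `a`. -/
structure Memory where
  nat : ℕ → ℕ → ℕ
  real : ℕ → ℕ → ℝ

/-- Natural number expressions (`sub` is truncated subtraction). -/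
inductive NatExp : Type
  | lit (k : ℕ)
  | get (a : ℕ) (i : NatExp)
  | add (e f : NatExp)
  | sub (e f : NatExp)

/-- Real number expressions. The only constants are natural numbers. -/
inductive RealExp : Type
  | lit (k : ℕ)
  | get (a : ℕ) (i : NatExp)
  | add (e f : RealExp)
  | sub (e f : RealExp)

/-- Conditions. -/
inductive Cond : Type
  | natLe (e f : NatExp)
  | realLe (e f : RealExp)
  | not (t : Cond)
  | and (t u : Cond)

/-- Programs: `setNat a i e` stores the value of `e` in the cell `i` of the natural number array
`a`, `setReal` likewise for reals, `branch t P Q` is "if `t` then `P` else `Q`", and `loop t P` is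
"while `t` do `P`". -/
inductive Program : Type
  | skip
  | setNat (a : ℕ) (i : NatExp) (e : NatExp)
  | setReal (a : ℕ) (i : NatExp) (e : RealExp)
  | seq (P Q : Program)
  | branch (t : Cond) (P Q : Program)
  | loop (t : Cond) (P : Program)

noncomputable section

/-- The value of a natural number expression. -/
def NatExp.eval (M : Memory) : NatExp → ℕ
  | lit k => k
  | get a i => M.nat a (i.eval M)
  | add e f => e.eval M + f.eval M
  | sub e f => e.eval M - f.eval M

/-- The number of steps to evaluate a natural number expression. -/
def NatExp.time : NatExp → ℕ
  | lit _ => 1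
  | get _ i => i.time + 1
  | add e f => e.time + f.time + 1
  | sub e f => e.time + f.time + 1

/-- The value of a real number expression. -/
def RealExp.eval (M : Memory) : RealExp → ℝ
  | lit k => k
  | get a i => M.real a (i.eval M)
  | add e f => e.eval M + f.eval M
  | sub e f => e.eval M - f.eval M

/-- The number of steps to evaluate a real number expression. -/
def RealExp.time : RealExp → ℕ
  | lit _ => 1
  | get _ i => i.time + 1
  | add e f => e.time + f.time + 1
  | sub e f => e.time + f.time + 1

/-- The truth value of a condition. -/
def Cond.Holds (M : Memory) : Cond → Prop
  | natLe e f => e.eval M ≤ f.eval M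
  | realLe e f => e.eval M ≤ f.eval M
  | not t => ¬ t.Holds M
  | and t u => t.Holds M ∧ u.Holds M

/-- The number of steps to test a condition. -/
def Cond.time : Cond → ℕ
  | natLe e f => e.time + f.time + 1
  | realLe e f => e.time + f.time + 1
  | not t => t.time + 1
  | and t u => t.time + u.time + 1

/-- Store the natural number `x` in the cell `i` of the natural number array `a`. -/
def Memory.setNat (M : Memory) (a i x : ℕ) : Memory where
  nat := Function.update M.nat a (Function.update (M.nat a) i x)
  real := M.real

/-- Store the real number `x` in the cell `i` of the real number array `a`. -/
def Memory.setReal (M : Memory) (a i : ℕ) (x : ℝ) : Memory where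
  nat := M.nat
  real := Function.update M.real a (Function.update (M.real a) i x)

/-- `Run P M t M'`: the program `P`, started in memory `M`, halts after exactly `t` steps in
memory `M'`. -/
inductive Run : Program → Memory → ℕ → Memory → Prop
  | skip (M : Memory) : Run .skip M 1 M
  | setNat (M : Memory) (a : ℕ) (i e : NatExp) :
      Run (.setNat a i e) M (i.time + e.time + 1) (M.setNat a (i.eval M) (e.eval M))
  | setReal (M : Memory) (a : ℕ) (i : NatExp) (e : RealExp) :
      Run (.setReal a i e) M (i.time + e.time + 1) (M.setReal a (i.eval M) (e.eval M))
  | seq {P Q : Program} {M₀ M₁ M₂ : Memory} {t₁ t₂ : ℕ} :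
      Run P M₀ t₁ M₁ → Run Q M₁ t₂ M₂ → Run (.seq P Q) M₀ (t₁ + t₂) M₂
  | branch_true {b : Cond} {P Q : Program} {M M' : Memory} {t : ℕ} :
      b.Holds M → Run P M t M' → Run (.branch b P Q) M (b.time + t + 1) M'
  | branch_false {b : Cond} {P Q : Program} {M M' : Memory} {t : ℕ} :
      ¬ b.Holds M → Run Q M t M' → Run (.branch b P Q) M (b.time + t + 1) M'
  | loop_false {b : Cond} {P : Program} {M : Memory} :
      ¬ b.Holds M → Run (.loop b P) M (b.time + 1) M
  | loop_true {b : Cond} {P : Program} {M₀ M₁ M₂ : Memory} {t₁ t₂ : ℕ} :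
      b.Holds M₀ → Run P M₀ t₁ M₁ → Run (.loop b P) M₁ t₂ M₂ →
      Run (.loop b P) M₀ (b.time + t₁ + t₂ + 1) M₂

/-! ## Input and output -/

open Classical in
/-- The memory in which a program is started on the instance `I`: natural number array `0` holds
`n` in its cell `0`, natural number array `1` holds the adjacency matrix of the graph row by row,
real array `0` holds the node costs, and real array `1` holds the budget in its cell `0`. All other
cells are zero. -/
def Instance.load {n : ℕ} (I : Instance n) : Memory where
  nat a k :=
    if a = 0 ∧ k = 0 then n
    else if a = 1 ∧ ∃ u v : Fin n, I.graph.Adj u v ∧ k = (u : ℕ) * n + (v : ℕ) then 1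
    else 0
  real a k :=
    if a = 0 then (if h : k < n then I.cost ⟨k, h⟩ else 0)
    else if a = 1 ∧ k = 0 then I.budget
    else 0

/-- The node set that a program has put out when it halts: the set of those nodes `v` for which
cell `v` of natural number array `2` is nonzero. -/
def Memory.output (n : ℕ) (M : Memory) : Finset (Fin n) :=
  Finset.univ.filter (fun v : Fin n => M.nat 2 v ≠ 0)

/-- Started on the instance `I`, the program `P` halts after at most `T` steps, and its output is
an optimal solution of `I`. -/
def SolvesWithin {n : ℕ} (P : Program) (I : Instance n) (T : ℕ) : Prop :=
  ∃ (t : ℕ) (M : Memory), Run P I.load t M ∧ t ≤ T ∧ I.IsOptimal (M.output n)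

end

end MBC

/-! In a tree any two nodes are joined by exactly one path, so every quotient in `GBC` is 0 or 1,
and `GBC G C` is the number of ordered pairs of distinct nodes minus the number of those joined by a
path that avoids `C` (`GBC_eq`). The task is to minimise the number of joined pairs within the
budget.

For a part `A` of the tree with root `r`, two numbers describe how `C` looks from outside: the
number `k` of nodes of `A` joined to `r` outside `C`, and the number `m` of joined pairs in
components that miss `r`. The `k` open nodes form one component, so the part has `m + k * (k - 1)`
joined pairs (`joinedPairs_eq`). As `m < n * n`, the state is one number `k * (n * n) + m`, and `k =
0` means exactly that `r` lies in `C`. There are fewer than `N = (n + 1) * (n * n)` states.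

When the part of a child is attached to that of its parent by an edge, the state of the union
depends only on the two states (`Joinable.code_union`). If the parent's root is in `C`, no pair
across the edge survives and the child's component is closed; otherwise open nodes stay open and
both coordinates add.

The dynamic program orders the nodes so that each is adjacent to an earlier one and, from the last
to the second, merges each part into that of its parent, keeping for every attainable state the
least cost and a pair of states that realises it. `Stage` is the invariant: every set is accounted
for at no more than its cost, and every table entry is realised by tracing back. `Stage.join`
preserves it, and `Stage.isOptimal` reads off a solution.

Children are attached one at a time, so there are `n - 1` merges whatever the degrees, each over `N
* N` pairs of states with `N = O(n ^ 3)`. This gives `O(n ^ 7)`. The remainder verifies a concrete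
program by loop invariants, with products and quotients obtained by repeated addition. -/

namespace MBC

open SimpleGraph Classical

/-! ### Paths in trees and connection outside a node set. -/

section Graph

variable {V : Type*} {G : SimpleGraph V}

/-- Some walk from `s` to `t` avoids `C`. -/
def Avoids (G : SimpleGraph V) (C : Finset V) (s t : V) : Prop :=
  ∃ p : G.Walk s t, ∀ x ∈ p.support, x ∉ C

namespace Avoids

variable {C : Finset V} {s t u : V}

theorem left (h : Avoids G C s t) : s ∉ C := by
  obtain ⟨p, hp⟩ := h
  exact hp _ p.start_mem_support

theorem refl (h : s ∉ C) : Avoids G C s s := ⟨.nil, by simpa using h⟩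

theorem symm (h : Avoids G C s t) : Avoids G C t s := by
  obtain ⟨p, hp⟩ := h
  exact ⟨p.reverse, by simpa using hp⟩

theorem trans (h : Avoids G C s t) (h' : Avoids G C t u) : Avoids G C s u := by
  obtain ⟨p, hp⟩ := h
  obtain ⟨q, hq⟩ := h'
  refine ⟨p.append q, fun x hx => ?_⟩
  rw [Walk.mem_support_append_iff] at hx
  exact hx.elim (hp x) (hq x)

theorem of_adj (h : G.Adj s t) (hs : s ∉ C) (ht : t ∉ C) : Avoids G C s t :=
  ⟨.cons h .nil, by simp [hs, ht]⟩

theorem exists_path (h : Avoids G C s t) :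
    ∃ p : G.Walk s t, p.IsPath ∧ ∀ x ∈ p.support, x ∉ C := by
  obtain ⟨p, hp⟩ := h
  exact ⟨p.bypass, p.bypass_isPath, fun x hx => hp x (p.support_bypass_subset_support hx)⟩

end Avoids

/-- Every path between two members of `A` stays in `A`. -/
def PathClosed (G : SimpleGraph V) (A : Finset V) : Prop :=
  ∀ s ∈ A, ∀ t ∈ A, ∀ p : G.Walk s t, p.IsPath → ∀ x ∈ p.support, x ∈ A

theorem pathClosed_singleton (v : V) : PathClosed G {v} := by
  intro s hs t ht p hp x hx
  rw [Finset.mem_singleton] at hs ht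
  subst hs
  subst ht
  have hnil := Walk.isPath_iff_nil.1 hp
  rw [Walk.nil_iff_support_eq.1 hnil] at hx
  simpa using hx

theorem path_eq_of_isTree (hG : G.IsTree) {s t : V} {p q : G.Walk s t} (hp : p.IsPath)
    (hq : q.IsPath) : p = q :=
  congrArg Subtype.val ((hG.isAcyclic.subsingleton_path s t).elim ⟨p, hp⟩ ⟨q, hq⟩)

/-- The paths from `s` to `u` inside `A` and from `v` to `t` inside `B`, glued along the edge, have
no common node and so form a path. By uniqueness of paths in a tree it is `p`. -/
theorem PathClosed.exists_split (hG : G.IsTree) {A B : Finset V} (hA : PathClosed G A)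
    (hB : PathClosed G B) (hAB : Disjoint A B) {u v s t : V} (hu : u ∈ A) (hv : v ∈ B)
    (huv : G.Adj u v) (hs : s ∈ A) (ht : t ∈ B) {p : G.Walk s t} (hp : p.IsPath) :
    ∃ (q : G.Walk s u) (r : G.Walk v t), q.IsPath ∧ r.IsPath ∧
      p.support = q.support ++ r.support := by
  obtain ⟨q, hq⟩ := (hG.connected s u).exists_isPath
  obtain ⟨r, hr⟩ := (hG.connected v t).exists_isPath
  have hsupp : (q.append (.cons huv r)).support = q.support ++ r.support := by
    simp [Walk.support_append]
  have hpath : (q.append (.cons huv r)).IsPath := by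
    rw [Walk.isPath_def, hsupp, List.nodup_append']
    refine ⟨hq.support_nodup, hr.support_nodup, fun x hx hx' => ?_⟩
    exact Finset.disjoint_left.1 hAB (hA s hs u hu q hq x hx) (hB v hv t ht r hr x hx')
  exact ⟨q, r, hq, hr, by rw [path_eq_of_isTree hG hp hpath, hsupp]⟩

theorem PathClosed.union [DecidableEq V] (hG : G.IsTree) {A B : Finset V} (hA : PathClosed G A)
    (hB : PathClosed G B) (hAB : Disjoint A B) {u v : V} (hu : u ∈ A) (hv : v ∈ B)
    (huv : G.Adj u v) : PathClosed G (A ∪ B) := by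
  intro s hs t ht p hp x hx
  rw [Finset.mem_union] at hs ht ⊢
  rcases hs with hs | hs <;> rcases ht with ht | ht
  · exact Or.inl (hA s hs t ht p hp x hx)
  · obtain ⟨q, r, hq, hr, h⟩ := hA.exists_split hG hB hAB hu hv huv hs ht hp
    rw [h, List.mem_append] at hx
    exact hx.imp (hA s hs u hu q hq x) (hB v hv t ht r hr x)
  · obtain ⟨q, r, hq, hr, h⟩ := hB.exists_split hG hA hAB.symm hv hu huv.symm hs ht hp
    rw [h, List.mem_append] at hx
    exact hx.symm.imp (hA u hu t ht r hr x) (hB s hs v hv q hq x)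
  · exact Or.inr (hB s hs t ht p hp x hx)

theorem PathClosed.avoids_of_avoids (hG : G.IsTree) {A B C : Finset V} (hA : PathClosed G A)
    (hB : PathClosed G B) (hAB : Disjoint A B) {u v s t : V} (hu : u ∈ A) (hv : v ∈ B)
    (huv : G.Adj u v) (hs : s ∈ A) (ht : t ∈ B) (h : Avoids G C s t) :
    Avoids G C s u ∧ Avoids G C v t := by
  obtain ⟨p, hp, hpC⟩ := h.exists_path
  obtain ⟨q, r, -, -, hqr⟩ := hA.exists_split hG hB hAB hu hv huv hs ht hp
  rw [hqr] at hpC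
  exact ⟨⟨q, fun x hx => hpC x (List.mem_append_left _ hx)⟩,
    ⟨r, fun x hx => hpC x (List.mem_append_right _ hx)⟩⟩

end Graph

/-! ### Joined pairs in a part and in a union of two parts. -/

section Counting

variable {V : Type*} {G : SimpleGraph V}

theorem card_filter_offDiag_union [DecidableEq V] {A B : Finset V} (hAB : Disjoint A B) (φ : V × V → Prop)
    [DecidablePred φ] (h : ∀ a ∈ A, ∀ b ∈ B, ¬ φ (a, b) ∧ ¬ φ (b, a)) :
    ((A ∪ B).offDiag.filter φ).card =
      (A.offDiag.filter φ).card + (B.offDiag.filter φ).card := by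
  rw [← Finset.card_union_of_disjoint]
  · congr 1
    ext ⟨x, y⟩
    simp only [Finset.mem_filter, Finset.mem_offDiag, Finset.mem_union]
    constructor
    · rintro ⟨⟨hx | hx, hy | hy, hne⟩, hφ⟩
      · exact Or.inl ⟨⟨hx, hy, hne⟩, hφ⟩
      · exact absurd hφ (h x hx y hy).1
      · exact absurd hφ (h y hy x hx).2
      · exact Or.inr ⟨⟨hx, hy, hne⟩, hφ⟩
    · rintro (⟨⟨hx, hy, hne⟩, hφ⟩ | ⟨⟨hx, hy, hne⟩, hφ⟩)
      · exact ⟨⟨Or.inl hx, Or.inl hy, hne⟩, hφ⟩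
      · exact ⟨⟨Or.inr hx, Or.inr hy, hne⟩, hφ⟩
  · rw [Finset.disjoint_left]
    rintro ⟨x, y⟩ hx hy
    simp only [Finset.mem_filter, Finset.mem_offDiag] at hx hy
    exact Finset.disjoint_left.1 hAB hx.1.1 hy.1.1

/-- The number of nodes of `A` that are joined to `r` outside `C`. -/
noncomputable def openSize (G : SimpleGraph V) (C : Finset V) (r : V) (A : Finset V) : ℕ :=
  (A.filter (Avoids G C r)).card

/-- The number of ordered pairs of distinct nodes of `A` that are joined outside `C`. -/
noncomputable def joinedPairs (G : SimpleGraph V) (C : Finset V) (A : Finset V) : ℕ :=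
  (A.offDiag.filter fun q => Avoids G C q.1 q.2).card

/-- The number of ordered pairs of distinct nodes of `A` that are joined outside `C`, but not
to `r`. -/
noncomputable def closedPairs (G : SimpleGraph V) (C : Finset V) (r : V) (A : Finset V) : ℕ :=
  (A.offDiag.filter fun q => Avoids G C q.1 q.2 ∧ ¬ Avoids G C r q.1).card

/-- Being joined outside `C` is transitive, so a joined pair has both ends open or neither. Any two
open nodes are joined through `r`, which gives the product. -/
theorem joinedPairs_eq (C : Finset V) (r : V) (A : Finset V) :
    joinedPairs G C A =
      closedPairs G C r A + openSize G C r A * (openSize G C r A - 1) := by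
  have h : (A.offDiag.filter fun q => Avoids G C q.1 q.2 ∧ Avoids G C r q.1) =
      (A.filter (Avoids G C r)).offDiag := by
    ext ⟨x, y⟩
    simp only [Finset.mem_filter, Finset.mem_offDiag]
    constructor
    · rintro ⟨⟨hx, hy, hne⟩, hxy, hr⟩
      exact ⟨⟨hx, hr⟩, ⟨hy, hr.trans hxy⟩, hne⟩
    · rintro ⟨⟨hx, hr⟩, ⟨hy, hr'⟩, hne⟩
      exact ⟨⟨hx, hy, hne⟩, hr.symm.trans hr', hr⟩
  have h2 := Finset.card_filter_add_card_filter_not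
    (s := A.offDiag.filter fun q => Avoids G C q.1 q.2) (fun q => Avoids G C r q.1)
  rw [Finset.filter_filter, Finset.filter_filter, h, Finset.offDiag_card] at h2
  rw [joinedPairs, ← h2, closedPairs, openSize, Nat.mul_sub, mul_one, add_comm]

theorem openSize_of_mem {C A : Finset V} {r : V} (h : r ∈ C) : openSize G C r A = 0 := by
  rw [openSize, Finset.card_eq_zero, Finset.filter_eq_empty_iff]
  exact fun x _ hx => hx.left h

theorem openSize_pos {C A : Finset V} {r : V} (hr : r ∈ A) (h : r ∉ C) :
    0 < openSize G C r A :=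
  Finset.card_pos.2 ⟨r, Finset.mem_filter.2 ⟨hr, .refl h⟩⟩

/-- Two disjoint path-closed node sets `A ∋ u` and `B ∋ v` joined by the edge `uv`. -/
structure Joinable (G : SimpleGraph V) (A B : Finset V) (u v : V) : Prop where
  tree : G.IsTree
  closed_left : PathClosed G A
  closed_right : PathClosed G B
  disj : Disjoint A B
  mem_left : u ∈ A
  mem_right : v ∈ B
  adj : G.Adj u v

namespace Joinable

variable {A B C : Finset V} {u v : V}

theorem avoids (h : Joinable G A B u v) {s t : V} (hs : s ∈ A) (ht : t ∈ B)
    (hst : Avoids G C s t) : Avoids G C s u ∧ Avoids G C v t :=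
  h.closed_left.avoids_of_avoids h.tree h.closed_right h.disj h.mem_left h.mem_right h.adj hs ht hst

theorem avoids_iff (h : Joinable G A B u v) (hv : v ∉ C) {s : V} (hs : s ∈ A) :
    Avoids G C v s ↔ Avoids G C u s := by
  constructor
  · exact fun hvs => (h.avoids hs h.mem_right hvs.symm).1.symm
  · exact fun hus => (Avoids.of_adj h.adj.symm hv hus.left).trans hus

theorem openSize_union [DecidableEq V] (h : Joinable G A B u v) (hv : v ∉ C) :
    openSize G C v (A ∪ B) = openSize G C v B + openSize G C u A := by
  rw [openSize, Finset.filter_union, Finset.card_union_of_disjoint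
    (Finset.disjoint_filter_filter h.disj), add_comm, openSize, openSize]
  congr 2
  exact Finset.filter_congr fun s hs => h.avoids_iff hv hs

/-- A joined pair across the edge is joined through `v`, hence never closed with respect to `v`.
Inside `A` the roots `u` and `v` see the same nodes by `avoids_iff`. -/
theorem closedPairs_union [DecidableEq V] (h : Joinable G A B u v) (hv : v ∉ C) :
    closedPairs G C v (A ∪ B) = closedPairs G C v B + closedPairs G C u A := by
  rw [closedPairs, card_filter_offDiag_union h.disj, add_comm, closedPairs, closedPairs]
  · congr 2
    refine Finset.filter_congr fun q hq => ?_
    rw [h.avoids_iff hv (Finset.mem_offDiag.1 hq).1]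
  · intro a ha b hb
    refine ⟨fun hab => ?_, fun hab => ?_⟩
    · exact hab.2 ((h.avoids ha hb hab.1).2.trans hab.1.symm)
    · exact hab.2 (h.avoids ha hb hab.1.symm).2

/-- Every path across the edge contains `v`, so a `v` in `C` destroys all mixed pairs. -/
theorem joinedPairs_union [DecidableEq V] (h : Joinable G A B u v) (hv : v ∈ C) :
    joinedPairs G C (A ∪ B) = joinedPairs G C B + joinedPairs G C A := by
  rw [joinedPairs, card_filter_offDiag_union h.disj, add_comm, joinedPairs, joinedPairs]
  intro a ha b hb
  exact ⟨fun hab => (h.avoids ha hb hab).2.left hv,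
    fun hab => (h.avoids ha hb hab.symm).2.left hv⟩

end Joinable

end Counting

/-! ### Codes -/

/-- The number of joined pairs that is encoded by `y = k * B + m`: the `m` closed ones and those
among the `k` nodes joined to the root. -/
def closeCode (B y : ℕ) : ℕ := y % B + y / B * (y / B - 1)

/-- The code of a union of two parts, where `x` belongs to the part that contains the new root. -/
def mergeCode (B x y : ℕ) : ℕ := if x < B then x + closeCode B y else x + y

section Code

variable {n : ℕ} {G : SimpleGraph (Fin n)}

/-- The state of the part `A` with root `r` for the solution `C`. -/
noncomputable def code (G : SimpleGraph (Fin n)) (C : Finset (Fin n)) (r : Fin n)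
    (A : Finset (Fin n)) : ℕ :=
  openSize G C r A * (n * n) + closedPairs G C r A

/-- The strict inequality makes `n * n` a valid base, so that quotient and remainder recover both
coordinates from the code. -/
theorem closedPairs_lt (C : Finset (Fin n)) (r : Fin n) (A : Finset (Fin n)) :
    closedPairs G C r A < n * n := by
  have h1 : closedPairs G C r A ≤ A.card * A.card - A.card :=
    (Finset.card_filter_le _ _).trans_eq A.offDiag_card
  have h2 : A.card ≤ n := by simpa using A.card_le_univ
  have h3 : 0 < n := r.pos
  rcases Nat.eq_zero_or_pos A.card with h | h
  · rw [h] at h1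
    exact (Nat.le_zero.1 h1).trans_lt (Nat.mul_pos h3 h3)
  · have := Nat.mul_le_mul h2 h2
    have := Nat.mul_pos h h
    omega

theorem code_lt (C : Finset (Fin n)) (r : Fin n) (A : Finset (Fin n)) :
    code G C r A < (n + 1) * (n * n) := by
  have h1 := closedPairs_lt (G := G) C r A
  have h2 : openSize G C r A ≤ n :=
    (Finset.card_filter_le _ _).trans (by simpa using A.card_le_univ)
  rw [code]
  nlinarith [Nat.mul_le_mul_right (n * n) h2]

theorem code_mod (C : Finset (Fin n)) (r : Fin n) (A : Finset (Fin n)) :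
    code G C r A % (n * n) = closedPairs G C r A := by
  rw [code, add_comm, Nat.add_mul_mod_self_right, Nat.mod_eq_of_lt (closedPairs_lt C r A)]

theorem code_div (C : Finset (Fin n)) (r : Fin n) (A : Finset (Fin n)) :
    code G C r A / (n * n) = openSize G C r A := by
  have h := closedPairs_lt (G := G) C r A
  rw [code, mul_comm, Nat.mul_add_div (by omega), Nat.div_eq_of_lt h, add_zero]

theorem closeCode_code (C : Finset (Fin n)) (r : Fin n) (A : Finset (Fin n)) :
    closeCode (n * n) (code G C r A) = joinedPairs G C A := by
  rw [closeCode, code_mod, code_div, joinedPairs_eq C r A]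

theorem code_of_mem {C A : Finset (Fin n)} {r : Fin n} (h : r ∈ C) :
    code G C r A = joinedPairs G C A := by
  rw [joinedPairs_eq C r A, code, openSize_of_mem h]
  simp

/-- A root outside `C` is joined to itself, so the open coordinate is positive. Thus the program can
tell from the code alone whether the root is chosen. -/
theorem code_lt_iff {C A : Finset (Fin n)} {r : Fin n} (hr : r ∈ A) :
    code G C r A < n * n ↔ r ∈ C := by
  constructor
  · intro h
    by_contra hC
    have := openSize_pos (G := G) hr hC
    rw [code] at h
    nlinarith
  · intro h
    have := closedPairs_lt (G := G) C r A
    rw [code, openSize_of_mem h]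
    simpa using this

/-- With `v` in `C`, the codes at `v` are plain numbers of joined pairs, and these add once the
child's component is closed. Otherwise both coordinates add, and with them the codes. -/
theorem Joinable.code_union {A B : Finset (Fin n)} {u v : Fin n} (h : Joinable G A B u v)
    (C : Finset (Fin n)) :
    code G C v (A ∪ B) = mergeCode (n * n) (code G C v B) (code G C u A) := by
  rw [mergeCode]
  split_ifs with hC
  · rw [code_lt_iff h.mem_right] at hC
    rw [code_of_mem hC, code_of_mem hC, closeCode_code, h.joinedPairs_union hC]
  · rw [code_lt_iff h.mem_right] at hC
    rw [code, code, code, h.openSize_union hC, h.closedPairs_union hC]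
    ring

theorem code_singleton (C : Finset (Fin n)) (r : Fin n) :
    code G C r {r} = if r ∈ C then 0 else n * n := by
  have h0 : closedPairs G C r {r} = 0 := by simp [closedPairs]
  rw [code, h0]
  split_ifs with h
  · simp [openSize_of_mem h]
  · have : openSize G C r {r} = 1 := by
      rw [openSize, Finset.filter_singleton, if_pos (Avoids.refl h), Finset.card_singleton]
    simp [this]

end Code

/-! ### Group betweenness centrality on trees. -/

section Centrality

variable {n : ℕ} {G : SimpleGraph (Fin n)}

theorem shortestPaths_eq (hG : G.IsTree) {s t : Fin n} {p : G.Walk s t} (hp : p.IsPath) :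
    shortestPaths G s t = {p} := by
  ext q
  rw [Set.mem_singleton_iff]
  constructor
  · exact fun hq => path_eq_of_isTree hG hq.1 hp
  · rintro rfl
    -- Some path realises the distance; being the only path, it is `q`.
    obtain ⟨r, hr, hlen⟩ := hG.connected.exists_path_of_dist s t
    rw [path_eq_of_isTree hG hp hr]
    exact ⟨hr, hlen⟩

theorem sigmaThrough_div_sigma (hG : G.IsTree) (C : Finset (Fin n)) (s t : Fin n) :
    (sigmaThrough G C s t : ℝ) / (sigma G s t : ℝ) = 1 - if Avoids G C s t then 1 else 0 := by
  obtain ⟨p, hp⟩ := (hG.connected s t).exists_isPath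
  have h1 : sigma G s t = 1 := by
    rw [sigma, shortestPaths_eq hG hp, Set.ncard_singleton]
  rw [h1, sigmaThrough, shortestPaths_eq hG hp]
  split_ifs with h
  · obtain ⟨q, hq, hqC⟩ := h.exists_path
    rw [path_eq_of_isTree hG hq hp] at hqC
    have : {q ∈ ({p} : Set (G.Walk s t)) | ∃ v ∈ C, v ∈ q.support} = ∅ := by
      ext q
      simp only [Set.mem_singleton_iff, Set.mem_ofPred_eq, Set.mem_empty_iff_false, iff_false]
      rintro ⟨rfl, v, hv, hvq⟩
      exact hqC v hvq hv
    rw [this]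
    simp
  · have : {q ∈ ({p} : Set (G.Walk s t)) | ∃ v ∈ C, v ∈ q.support} = {p} := by
      ext q
      simp only [Set.mem_singleton_iff, Set.mem_ofPred_eq, and_iff_left_iff_imp]
      rintro rfl
      by_contra! hcon
      exact h ⟨q, fun x hx hxC => hcon x hxC hx⟩
    rw [this]
    simp

theorem GBC_eq (hG : G.IsTree) (C : Finset (Fin n)) :
    GBC G C = ((Finset.univ : Finset (Fin n)).offDiag.card : ℝ) -
      joinedPairs G C Finset.univ := by
  have h : GBC G C = ∑ q ∈ (Finset.univ : Finset (Fin n)).offDiag,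
      (1 - if Avoids G C q.1 q.2 then (1 : ℝ) else 0) := by
    rw [GBC, Finset.sum_sigma']
    refine Finset.sum_bij' (fun x _ => (x.1, x.2)) (fun x _ => ⟨x.1, x.2⟩) ?_ ?_ ?_ ?_ ?_
    · simp
    · simp
    · simp
    · simp
    · rintro ⟨s, t⟩ -
      exact sigmaThrough_div_sigma hG C s t
  rw [h, Finset.sum_sub_distrib, joinedPairs, Finset.card_filter]
  simp

end Centrality

end MBC

namespace MBC

open SimpleGraph

/-! ### The dynamic program -/

/-- Undoing the join of the part `i` to the part `par i`: from the code of the union, kept at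
`par i`, to the codes of both parts. -/
def traceStep (par : ℕ → ℕ) (bl br : ℕ → ℕ → ℕ) (i : ℕ) (cur : ℕ → ℕ) : ℕ → ℕ :=
  Function.update (Function.update cur (par i) (bl i (cur (par i)))) i (br i (cur (par i)))

/-- Undoing the joins of the parts `i, i + 1, …, i + k - 1`. -/
def trace (par : ℕ → ℕ) (bl br : ℕ → ℕ → ℕ) : ℕ → ℕ → (ℕ → ℕ) → ℕ → ℕ
  | 0, _, cur => cur
  | k + 1, i, cur => trace par bl br k (i + 1) (traceStep par bl br i cur)

/-- The nodes `o j` with `cur j = 0`. -/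
def chosen {n : ℕ} (o : ℕ → Fin n) (cur : ℕ → ℕ) : Finset (Fin n) :=
  ((Finset.range n).filter fun j => cur j = 0).image o

/-- The nodes `o 0, …, o (n - 1)` are all nodes, each but the first one adjacent to the earlier
one `o (par j)`. -/
structure IsOrdering {n : ℕ} (G : SimpleGraph (Fin n)) (o : ℕ → Fin n) (par : ℕ → ℕ) : Prop where
  inj : ∀ j < n, ∀ k < n, o j = o k → j = k
  par_lt : ∀ j, 0 < j → j < n → par j < j
  adj : ∀ j, 0 < j → j < n → G.Adj (o (par j)) (o j)

theorem IsOrdering.surj {n : ℕ} {G : SimpleGraph (Fin n)} {o : ℕ → Fin n} {par : ℕ → ℕ}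
    (h : IsOrdering G o par) (v : Fin n) : ∃ j < n, o j = v := by
  have hinj : Function.Injective fun j : Fin n => o j := fun j k hjk =>
    Fin.ext (h.inj j j.2 k k.2 hjk)
  obtain ⟨j, hj⟩ := Finite.surjective_of_injective hinj v
  exact ⟨j, j.2, hj⟩

theorem mem_chosen {n : ℕ} {G : SimpleGraph (Fin n)} {o : ℕ → Fin n} {par : ℕ → ℕ}
    (h : IsOrdering G o par) {cur : ℕ → ℕ} {j : ℕ} (hj : j < n) :
    o j ∈ chosen o cur ↔ cur j = 0 := by
  simp only [chosen, Finset.mem_image, Finset.mem_filter, Finset.mem_range]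
  constructor
  · rintro ⟨k, ⟨hk, hk0⟩, hkj⟩
    rwa [← h.inj k hk j hj hkj]
  · exact fun h0 => ⟨j, ⟨hj, h0⟩, rfl⟩

/-- The tables after the joins of the parts `n - 1, …, i`: `vd j x` tells whether the code `x` is
attained at the part `A j`, and `D j x` is the least cost for which it is attained. -/
structure Stage {n : ℕ} (I : Instance n) (o : ℕ → Fin n) (par : ℕ → ℕ) (i : ℕ)
    (vd : ℕ → ℕ → Prop) (D : ℕ → ℕ → ℝ) (bl br : ℕ → ℕ → ℕ) (A : ℕ → Finset (Fin n)) : Prop where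
  closed : ∀ j < i, PathClosed I.graph (A j)
  mem : ∀ j < i, o j ∈ A j
  disj : ∀ j < i, ∀ k < i, j ≠ k → Disjoint (A j) (A k)
  cover : ∀ v, ∃ j < i, v ∈ A j
  complete : ∀ C, ∀ j < i, vd j (code I.graph C (o j) (A j)) ∧
    D j (code I.graph C (o j) (A j)) ≤ ∑ v ∈ C ∩ A j, I.cost v
  sound : ∀ bl' br' : ℕ → ℕ → ℕ,
    (∀ j, i ≤ j → j < n → ∀ z < (n + 1) * (n * n), bl' j z = bl j z ∧ br' j z = br j z) →
    ∀ cur : ℕ → ℕ, (∀ j < i, vd j (cur j)) → ∀ j < i,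
      code I.graph (chosen o (trace par bl' br' (n - i) i cur)) (o j) (A j) = cur j ∧
      ∑ v ∈ chosen o (trace par bl' br' (n - i) i cur) ∩ A j, I.cost v = D j (cur j)

namespace Stage

variable {n : ℕ} {I : Instance n} {o : ℕ → Fin n} {par : ℕ → ℕ} {i : ℕ}
  {vd vd' : ℕ → ℕ → Prop} {D D' : ℕ → ℕ → ℝ} {bl br bl' br' : ℕ → ℕ → ℕ}
  {A : ℕ → Finset (Fin n)}

theorem init (ho : IsOrdering I.graph o par) (bl br : ℕ → ℕ → ℕ)
    (hvd : ∀ j < n, ∀ x, vd j x ↔ x = 0 ∨ x = n * n)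
    (hD₀ : ∀ j < n, D j 0 = I.cost (o j)) (hD₁ : ∀ j < n, D j (n * n) = 0) :
    Stage I o par n vd D bl br fun j => {o j} where
  closed j _ := pathClosed_singleton _
  mem j _ := Finset.mem_singleton_self _
  disj j hj k hk hjk := by
    rw [Finset.disjoint_singleton]
    exact fun h => hjk (ho.inj j hj k hk h)
  cover v := by
    obtain ⟨j, hj, hjv⟩ := ho.surj v
    exact ⟨j, hj, Finset.mem_singleton.2 hjv.symm⟩
  complete C j hj := by
    rw [code_singleton, hvd j hj]
    split_ifs with h
    · refine ⟨Or.inl rfl, ?_⟩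
      rw [hD₀ j hj, Finset.inter_singleton_of_mem h, Finset.sum_singleton]
    · refine ⟨Or.inr rfl, ?_⟩
      rw [hD₁ j hj, Finset.inter_singleton_of_notMem h, Finset.sum_empty]
  sound bl' br' _ cur hcur j hj := by
    have hn : n * n ≠ 0 := by
      have : 0 < n := by omega
      positivity
    rw [Nat.sub_self, trace, code_singleton]
    rcases (hvd j hj _).1 (hcur j hj) with h | h
    · rw [if_pos ((mem_chosen ho hj).2 h), h, hD₀ j hj, Finset.inter_singleton_of_mem ((mem_chosen ho hj).2 h),
        Finset.sum_singleton]
      exact ⟨rfl, rfl⟩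
    · have h0 : cur j ≠ 0 := by rwa [h]
      have hm : o j ∉ chosen o cur := fun hm => h0 ((mem_chosen ho hj).1 hm)
      rw [if_neg hm, h, hD₁ j hj, Finset.inter_singleton_of_notMem hm,
        Finset.sum_empty]
      exact ⟨rfl, rfl⟩

/-- Since `sound` prescribes the codes of all parts at once, attainable codes of different parts are
attained by one common set, with no separate gluing argument. -/
theorem exists_code (h : Stage I o par i vd D bl br A) {cur : ℕ → ℕ}
    (hcur : ∀ j < i, vd j (cur j)) : ∃ C, ∀ j < i, code I.graph C (o j) (A j) = cur j :=
  ⟨_, fun j hj => (h.sound bl br (fun _ _ _ _ _ => ⟨rfl, rfl⟩) cur hcur j hj).1⟩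

theorem joinable (h : Stage I o par (i + 1) vd D bl br A) (hG : I.graph.IsTree)
    (ho : IsOrdering I.graph o par) (hi : 0 < i) (hin : i < n) :
    Joinable I.graph (A i) (A (par i)) (o i) (o (par i)) where
  tree := hG
  closed_left := h.closed i i.lt_succ_self
  closed_right := h.closed _ ((ho.par_lt i hi hin).trans i.lt_succ_self)
  disj := h.disj _ i.lt_succ_self _ ((ho.par_lt i hi hin).trans i.lt_succ_self)
    (ho.par_lt i hi hin).ne'
  mem_left := h.mem i i.lt_succ_self
  mem_right := h.mem _ ((ho.par_lt i hi hin).trans i.lt_succ_self)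
  adj := (ho.adj i hi hin).symm

/-- For arbitrary numbers below the bound this can fail. Attainable `x` and `y` are codes of one and
the same set, so their merge is the code of a union of parts and `code_lt` applies. This keeps the
new table within its `N` cells. -/
theorem mergeCode_lt (h : Stage I o par (i + 1) vd D bl br A) (hG : I.graph.IsTree)
    (ho : IsOrdering I.graph o par) (hi : 0 < i) (hin : i < n) {x y : ℕ}
    (hx : vd (par i) x) (hy : vd i y) : mergeCode (n * n) x y < (n + 1) * (n * n) := by
  have hp := ho.par_lt i hi hin
  -- The remaining parts also need some attainable code; that of the empty set serves.
  obtain ⟨C, hC⟩ := h.exists_code (cur := fun j =>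
      if j = i then y else if j = par i then x else code I.graph ∅ (o j) (A j)) (by
    intro j hj
    split_ifs with h1 h2
    · rwa [h1]
    · rwa [h2]
    · exact (h.complete ∅ j hj).1)
  have h1 := hC i i.lt_succ_self
  have h2 := hC (par i) (by omega)
  simp only [if_true, hp.ne, if_false] at h1 h2
  rw [← h1, ← h2, ← (h.joinable hG ho hi hin).code_union]
  exact code_lt _ _ _

/-- Here `hnew` says that each new entry comes from two old ones of the right merge and total cost,
and `hall` that no pair of old entries does better. They yield `sound` and `complete` respectively.
Costs add because the parts are disjoint. -/
theorem join (h : Stage I o par (i + 1) vd D bl br A) (hG : I.graph.IsTree)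
    (ho : IsOrdering I.graph o par) (hi : 0 < i) (hin : i < n)
    (hvd : ∀ j < i, j ≠ par i → ∀ x, vd' j x ↔ vd j x)
    (hD : ∀ j < i, j ≠ par i → ∀ x, vd j x → D' j x = D j x)
    (hb : ∀ j, i < j → j < n → ∀ z < (n + 1) * (n * n), bl' j z = bl j z ∧ br' j z = br j z)
    (hnew : ∀ z, vd' (par i) z → z < (n + 1) * (n * n) ∧ vd (par i) (bl' i z) ∧ vd i (br' i z) ∧
      mergeCode (n * n) (bl' i z) (br' i z) = z ∧
      D' (par i) z = D (par i) (bl' i z) + D i (br' i z))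
    (hall : ∀ x y, vd (par i) x → vd i y → vd' (par i) (mergeCode (n * n) x y) ∧
      D' (par i) (mergeCode (n * n) x y) ≤ D (par i) x + D i y) :
    Stage I o par i vd' D' bl' br' (Function.update A (par i) (A i ∪ A (par i))) := by
  have hp := ho.par_lt i hi hin
  have hJ := h.joinable hG ho hi hin
  have hsum : ∀ C : Finset (Fin n), ∑ v ∈ C ∩ (A i ∪ A (par i)), I.cost v =
      ∑ v ∈ C ∩ A (par i), I.cost v + ∑ v ∈ C ∩ A i, I.cost v := by
    intro C
    rw [Finset.inter_union_distrib_left, Finset.sum_union, add_comm]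
    exact hJ.disj.mono Finset.inter_subset_right Finset.inter_subset_right
  refine ⟨?_, ?_, ?_, ?_, ?_, ?_⟩
  · intro j hj
    rcases eq_or_ne j (par i) with rfl | hne
    · rw [Function.update_self]
      exact hJ.closed_left.union hG hJ.closed_right hJ.disj hJ.mem_left hJ.mem_right hJ.adj
    · rw [Function.update_of_ne hne]
      exact h.closed j (by omega)
  · intro j hj
    rcases eq_or_ne j (par i) with rfl | hne
    · rw [Function.update_self]
      exact Finset.mem_union_right _ hJ.mem_right
    · rw [Function.update_of_ne hne]
      exact h.mem j (by omega)
  · have key : ∀ k < i, k ≠ par i → Disjoint (A i ∪ A (par i)) (A k) := by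
      intro k hk hne
      rw [Finset.disjoint_union_left]
      exact ⟨h.disj i (by omega) k (by omega) (by omega),
        h.disj (par i) (by omega) k (by omega) hne.symm⟩
    intro j hj k hk hjk
    rcases eq_or_ne j (par i) with rfl | hne
    · rw [Function.update_self, Function.update_of_ne hjk.symm]
      exact key k hk hjk.symm
    · rw [Function.update_of_ne hne]
      rcases eq_or_ne k (par i) with rfl | hne'
      · rw [Function.update_self]
        exact (key j hj hne).symm
      · rw [Function.update_of_ne hne']
        exact h.disj j (by omega) k (by omega) hjk
  · intro v
    obtain ⟨j, hj, hv⟩ := h.cover v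
    by_cases hji : j = i ∨ j = par i
    · refine ⟨par i, hp, ?_⟩
      rw [Function.update_self, Finset.mem_union]
      rcases hji with rfl | rfl
      · exact Or.inl hv
      · exact Or.inr hv
    · push Not at hji
      refine ⟨j, by omega, ?_⟩
      rwa [Function.update_of_ne hji.2]
  · intro C j hj
    rcases eq_or_ne j (par i) with rfl | hne
    · rw [Function.update_self, hJ.code_union, hsum]
      obtain ⟨h1, h2⟩ := h.complete C (par i) (by omega)
      obtain ⟨h3, h4⟩ := h.complete C i (by omega)
      obtain ⟨h5, h6⟩ := hall _ _ h1 h3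
      exact ⟨h5, h6.trans (add_le_add h2 h4)⟩
    · rw [Function.update_of_ne hne, hvd j hj hne]
      obtain ⟨h1, h2⟩ := h.complete C j (by omega)
      rw [hD j hj hne _ h1]
      exact ⟨h1, h2⟩
  · intro bl'' br'' hb'' cur hcur
    obtain ⟨hz, hx, hy, hxy, hz'⟩ := hnew _ (hcur _ hp)
    obtain ⟨e1, e2⟩ := hb'' i le_rfl hin _ hz
    -- Tracing back from stage `i` first undoes the join of part `i`, the latest one made, and
    -- continues as from stage `i + 1`.
    have hni : n - i = (n - (i + 1)) + 1 := by omega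
    rw [hni, trace]
    have hsi : traceStep par bl'' br'' i cur i = br' i (cur (par i)) := by
      rw [traceStep, Function.update_self, e2]
    have hsp : traceStep par bl'' br'' i cur (par i) = bl' i (cur (par i)) := by
      rw [traceStep, Function.update_of_ne hp.ne, Function.update_self, e1]
    have hso : ∀ j, j ≠ i → j ≠ par i → traceStep par bl'' br'' i cur j = cur j := by
      intro j h1 h2
      rw [traceStep, Function.update_of_ne h1, Function.update_of_ne h2]
    have hs := h.sound bl'' br'' (fun j hj hjn z hz => by
        rw [(hb'' j (by omega) hjn z hz).1, (hb'' j (by omega) hjn z hz).2]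
        exact hb j hj hjn z hz) (traceStep par bl'' br'' i cur) (by
      intro j hj
      rcases eq_or_ne j i with rfl | h1
      · rwa [hsi]
      · rcases eq_or_ne j (par i) with rfl | h2
        · rwa [hsp]
        · rw [hso j h1 h2, ← hvd j (by omega) h2]
          exact hcur j (by omega))
    intro j hj
    rcases eq_or_ne j (par i) with rfl | hne
    · obtain ⟨h1, h2⟩ := hs i (by omega)
      obtain ⟨h3, h4⟩ := hs (par i) (by omega)
      rw [Function.update_self, hJ.code_union, hsum, h1, h2, h3, h4, hsi, hsp, hz']
      exact ⟨hxy, rfl⟩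
    · rw [Function.update_of_ne hne]
      have hj' := hs j (by omega)
      rw [hso j (by omega) hne] at hj'
      rw [hD j hj hne _ ((hvd j hj hne _).1 (hcur j hj))]
      exact hj'

/-- One part is left, the whole tree. Any affordable `C` has a code that is attainable at no more
than its cost, so the selected code has no more joined pairs, and `GBC_eq` reverses the inequality.
-/
theorem isOptimal (h : Stage I o par 1 vd D bl br A) (hG : I.graph.IsTree) {cur : ℕ → ℕ}
    (h0 : vd 0 (cur 0)) (hcost : D 0 (cur 0) ≤ I.budget)
    (hmin : ∀ x, vd 0 x → D 0 x ≤ I.budget → closeCode (n * n) (cur 0) ≤ closeCode (n * n) x)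
    (hbl : ∀ j, 1 ≤ j → j < n → ∀ z < (n + 1) * (n * n), bl' j z = bl j z ∧ br' j z = br j z) :
    I.IsOptimal (chosen o (trace par bl' br' (n - 1) 1 cur)) := by
  have hA : A 0 = Finset.univ := by
    ext v
    obtain ⟨j, hj, hv⟩ := h.cover v
    obtain rfl : j = 0 := by omega
    simpa using hv
  have hs := h.sound bl' br' hbl cur
    (fun j hj => by obtain rfl : j = 0 := by omega
                    exact h0) 0 one_pos
  rw [hA, Finset.inter_univ] at hs
  refine ⟨?_, fun C hC => ?_⟩
  · rw [Instance.IsFeasible, hs.2]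
    exact hcost
  · obtain ⟨h1, h2⟩ := h.complete C 0 one_pos
    rw [hA] at h1 h2
    rw [Finset.inter_univ] at h2
    have h3 := hmin _ h1 (h2.trans hC)
    rw [← hs.1, closeCode_code, closeCode_code] at h3
    rw [GBC_eq hG, GBC_eq hG]
    have : (joinedPairs I.graph (chosen o (trace par bl' br' (n - 1) 1 cur)) Finset.univ : ℝ) ≤
      joinedPairs I.graph C Finset.univ := by exact_mod_cast h3
    linarith

theorem exists_feasible (h : Stage I o par 1 vd D bl br A) : ∃ x, vd 0 x ∧ D 0 x ≤ I.budget := by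
  obtain ⟨h1, h2⟩ := h.complete ∅ 0 one_pos
  refine ⟨_, h1, h2.trans ?_⟩
  simpa using I.budget_nonneg

end Stage

/-! ### Reasoning about programs -/

/-- The program `P`, started in `M`, halts after at most `T` steps in a memory with `Q`. -/
def Tri (P : Program) (M : Memory) (T : ℕ) (Q : Memory → Prop) : Prop :=
  ∃ t M', Run P M t M' ∧ t ≤ T ∧ Q M'

theorem Tri.mono {P : Program} {M : Memory} {T T' : ℕ} {Q Q' : Memory → Prop}
    (h : Tri P M T Q) (hT : T ≤ T') (hQ : ∀ M', Q M' → Q' M') : Tri P M T' Q' := by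
  obtain ⟨t, M', hr, ht, hq⟩ := h
  exact ⟨t, M', hr, ht.trans hT, hQ M' hq⟩

theorem Tri.seq {P P' : Program} {M : Memory} {T T' : ℕ} {Q Q' : Memory → Prop}
    (h : Tri P M T Q) (h' : ∀ M', Q M' → Tri P' M' T' Q') : Tri (P.seq P') M (T + T') Q' := by
  obtain ⟨t, M', hr, ht, hq⟩ := h
  obtain ⟨t', M'', hr', ht', hq'⟩ := h' M' hq
  exact ⟨t + t', M'', hr.seq hr', Nat.add_le_add ht ht', hq'⟩

/-- The program has no loops. -/
def Program.LoopFree : Program → Prop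
  | .seq P Q => P.LoopFree ∧ Q.LoopFree
  | .branch _ P Q => P.LoopFree ∧ Q.LoopFree
  | .loop _ _ => False
  | _ => True

/-- A bound on the number of steps of a loop-free program. -/
def Program.maxTime : Program → ℕ
  | .skip => 1
  | .setNat _ i e => i.time + e.time + 1
  | .setReal _ i e => i.time + e.time + 1
  | .seq P Q => P.maxTime + Q.maxTime
  | .branch t P Q => t.time + max P.maxTime Q.maxTime + 1
  | .loop _ _ => 0

open Classical in
/-- The memory after running a loop-free program. -/
noncomputable def Program.exec : Program → Memory → Memory
  | .skip, M => M
  | .setNat a i e, M => M.setNat a (i.eval M) (e.eval M)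
  | .setReal a i e, M => M.setReal a (i.eval M) (e.eval M)
  | .seq P Q, M => Q.exec (P.exec M)
  | .branch t P Q, M => if t.Holds M then P.exec M else Q.exec M
  | .loop _ _, M => M

/-- Reduces loop-free code to computing `exec` by `simp` and bounding `maxTime`, a closed numeral
for concrete programs, by `decide`. -/
theorem Tri.exec {P : Program} (hP : P.LoopFree) {M : Memory} {T : ℕ} {Q : Memory → Prop}
    (hT : P.maxTime ≤ T) (hQ : Q (P.exec M)) : Tri P M T Q := by
  suffices h : ∀ M, ∃ t ≤ P.maxTime, Run P M t (P.exec M) by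
    obtain ⟨t, ht, hr⟩ := h M
    exact ⟨t, _, hr, ht.trans hT, hQ⟩
  clear hT hQ
  induction P with
  | skip => exact fun M => ⟨1, le_rfl, .skip M⟩
  | setNat a i e => exact fun M => ⟨_, le_rfl, .setNat M a i e⟩
  | setReal a i e => exact fun M => ⟨_, le_rfl, .setReal M a i e⟩
  | seq P P' ih ih' =>
    intro M
    obtain ⟨t, ht, hr⟩ := ih hP.1 M
    obtain ⟨t', ht', hr'⟩ := ih' hP.2 (P.exec M)
    exact ⟨t + t', Nat.add_le_add ht ht', hr.seq hr'⟩
  | branch b P P' ih ih' =>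
    intro M
    rw [Program.exec, Program.maxTime]
    split_ifs with hb
    · obtain ⟨t, ht, hr⟩ := ih hP.1 M
      exact ⟨_, by omega, .branch_true hb hr⟩
    · obtain ⟨t, ht, hr⟩ := ih' hP.2 M
      exact ⟨_, by omega, .branch_false hb hr⟩
  | loop b P => exact hP.elim

/-- The value of the variable `a`. -/
abbrev NatExp.var (a : ℕ) : NatExp := .get a (.lit 0)

/-- "For `v = 0, …, b - 1` do `P`". -/
def forUp (v : ℕ) (b : NatExp) (P : Program) : Program :=
  .seq (.setNat v (.lit 0) (.lit 0))
    (.loop (.natLe (.add (.var v) (.lit 1)) b)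
      (.seq P (.setNat v (.lit 0) (.add (.var v) (.lit 1)))))

/-- Besides the body, a round takes `e.time + 5` steps for the test, 1 for the loop and 6 for the
increment. The final test takes `e.time + 6` and the initialisation 3. The invariant is stated with
the counter already advanced. -/
theorem Tri.forUp {v : ℕ} {e : NatExp} {P : Program} {M : Memory} {b T T' : ℕ}
    {Q : Memory → Prop} (Inv : ℕ → Memory → Prop)
    (hT' : b * (T + e.time + 12) + e.time + 9 ≤ T')
    (h0 : Inv 0 (M.setNat v 0 0))
    (hinv : ∀ k M, Inv k M → M.nat v 0 = k ∧ e.eval M = b)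
    (hstep : ∀ k < b, ∀ M, Inv k M →
      Tri P M T fun M' => M'.nat v 0 = k ∧ Inv (k + 1) (M'.setNat v 0 (k + 1)))
    (hend : ∀ M, Inv b M → Q M) : Tri (forUp v e P) M T' Q := by
  -- Induction on the number `d` of rounds still to come.
  have key : ∀ d k, k + d = b → ∀ M, Inv k M →
      Tri (.loop (.natLe (.add (.var v) (.lit 1)) e)
        (.seq P (.setNat v (.lit 0) (.add (.var v) (.lit 1))))) M
        (d * (T + e.time + 12) + e.time + 6) Q := by
    intro d
    induction d with
    | zero =>
      intro k hk M hM
      obtain ⟨h1, h2⟩ := hinv k M hM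
      obtain rfl : k = b := by omega
      refine ⟨_, M, .loop_false ?_, ?_, hend M hM⟩
      · simp only [Cond.Holds, NatExp.eval, h1, h2]
        omega
      · simp only [Cond.time, NatExp.time]
        omega
    | succ d ih =>
      intro k hk M hM
      obtain ⟨h1, h2⟩ := hinv k M hM
      obtain ⟨t, M₁, hr, ht, hv, hM₁⟩ := hstep k (by omega) M hM
      obtain ⟨t', M₂, hr', ht', hQ⟩ := ih (k + 1) (by omega) _ hM₁
      refine ⟨_, M₂, .loop_true ?_ (hr.seq (.setNat _ _ _ _)) (M₂ := M₂) (t₂ := t') ?_, ?_, hQ⟩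
      · simp only [Cond.Holds, NatExp.eval, h1, h2]
        omega
      · simpa only [NatExp.eval, hv] using hr'
      · simp only [Cond.time, NatExp.time, Nat.succ_mul]
        omega
  obtain ⟨t, M', hr, ht, hQ⟩ := key b 0 (by omega) _ h0
  exact ⟨_, M', (Run.setNat M v _ _).seq hr, by simp only [NatExp.time]; omega, hQ⟩

/-- The memories agree but for the natural number arrays in `S` and the real arrays in `S'`. -/
structure Same (S S' : List ℕ) (M M' : Memory) : Prop where
  nat : ∀ a, a ∉ S → M'.nat a = M.nat a
  real : ∀ a, a ∉ S' → M'.real a = M.real a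

namespace Same

variable {S S' : List ℕ} {M M' M'' : Memory}

theorem refl : Same S S' M M := ⟨fun _ _ => rfl, fun _ _ => rfl⟩

theorem trans (h : Same S S' M M') (h' : Same S S' M' M'') : Same S S' M M'' :=
  ⟨fun a ha => (h'.nat a ha).trans (h.nat a ha), fun a ha => (h'.real a ha).trans (h.real a ha)⟩

theorem setNat (h : Same S S' M M') {a : ℕ} (ha : a ∈ S) (i x : ℕ) :
    Same S S' M (M'.setNat a i x) := by
  refine ⟨fun b hb => ?_, h.real⟩
  have hba : b ≠ a := fun hba => hb (hba ▸ ha)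
  exact (Function.update_of_ne hba _ _).trans (h.nat b hb)

theorem setReal (h : Same S S' M M') {a : ℕ} (ha : a ∈ S') (i : ℕ) (x : ℝ) :
    Same S S' M (M'.setReal a i x) := by
  refine ⟨h.nat, fun b hb => ?_⟩
  have hba : b ≠ a := fun hba => hb (hba ▸ ha)
  exact (Function.update_of_ne hba _ _).trans (h.real b hb)

theorem weaken {R R' : List ℕ} (h : Same S S' M M') (hS : S ⊆ R) (hS' : S' ⊆ R') :
    Same R R' M M' :=
  ⟨fun a ha => h.nat a fun h => ha (hS h), fun a ha => h.real a fun h => ha (hS' h)⟩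

end Same

theorem Memory.setNat_nat (M : Memory) (a i x b : ℕ) :
    (M.setNat a i x).nat b = if b = a then Function.update (M.nat a) i x else M.nat b :=
  Function.update_apply _ _ _ _

theorem Memory.setNat_real (M : Memory) (a i x : ℕ) : (M.setNat a i x).real = M.real := rfl

theorem Memory.setReal_nat (M : Memory) (a i : ℕ) (x : ℝ) : (M.setReal a i x).nat = M.nat := rfl

theorem Memory.setReal_real (M : Memory) (a i : ℕ) (x : ℝ) (b : ℕ) :
    (M.setReal a i x).real b = if b = a then Function.update (M.real a) i x else M.real b :=
  Function.update_apply _ _ _ _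

/-! ### The program -/

namespace Program

/-- Assign to the variable `a`. -/
abbrev setVar (a : ℕ) (e : NatExp) : Program := .setNat a (.lit 0) e

/-- Row offsets `v * n` in array `3`, `n * n` in variable `20`. -/
def rowOffsets : Program :=
  forUp 22 (.var 0) (.seq (.setNat 3 (.var 22) (.var 20)) (setVar 20 (.add (.var 20) (.var 0))))

/-- The number `(n + 1) * (n * n)` of codes in variable `21`. -/
def codeCount : Program :=
  forUp 22 (.add (.var 0) (.lit 1)) (setVar 21 (.add (.var 21) (.var 20)))

/-- The function `closeCode` in array `8`. -/
def closeTable : Program :=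
  forUp 22 (.var 21) (.branch (.natLe (.var 20) (.var 22))
    (.seq (.setNat 8 (.var 22) (.add (.get 8 (.sub (.var 22) (.var 20)))
        (.add (.get 7 (.sub (.var 22) (.var 20))) (.get 7 (.sub (.var 22) (.var 20))))))
      (.setNat 7 (.var 22) (.add (.get 7 (.sub (.var 22) (.var 20))) (.lit 1))))
    (.setNat 8 (.var 22) (.var 22)))

/-- Find an edge from the first `i + 1` nodes of the order to a new node. -/
def findEdge : Program :=
  forUp 23 (.add (.var 22) (.lit 1)) (forUp 24 (.var 0)
    (.branch (.and (.natLe (.get 4 (.var 24)) (.lit 0))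
        (.natLe (.lit 1) (.get 1 (.add (.get 3 (.get 5 (.var 23))) (.var 24)))))
      (.seq (setVar 25 (.var 24)) (setVar 26 (.var 23))) .skip))

/-- The nodes in array `5`, each after the first one with the position of an earlier neighbour in
array `6`. -/
def orderNodes : Program :=
  .seq (.setNat 4 (.lit 0) (.lit 1))
    (forUp 22 (.sub (.var 0) (.lit 1)) (.seq findEdge
      (.seq (.setNat 5 (.add (.var 22) (.lit 1)) (.var 25))
        (.seq (.setNat 6 (.add (.var 22) (.lit 1)) (.var 26)) (.setNat 4 (.var 25) (.lit 1))))))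

/-- The tables of the single nodes. -/
def initTables : Program :=
  forUp 22 (.var 0) (.seq (.setNat 9 (.var 22) (.var 27))
    (.seq (.setNat 10 (.var 27) (.lit 1))
      (.seq (.setReal 2 (.var 27) (.get 0 (.get 5 (.var 22))))
        (.seq (.setNat 10 (.add (.var 27) (.var 20)) (.lit 1))
          (setVar 27 (.add (.var 27) (.var 21)))))))

/-- The address of the entry `x` of the table of the parent. -/
def leftAddr : NatExp := .add (.get 9 (.get 6 (.var 28))) (.var 29)

/-- The address of the entry `y` of the table of the child. -/
def rightAddr : NatExp := .add (.get 9 (.var 28)) (.var 30)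

/-- The address of the new entry for the codes `x` and `y` in variable `31`. -/
def joinTarget : Program :=
  .branch (.natLe (.var 20) (.var 29))
    (setVar 31 (.add (.var 27) (.add (.var 29) (.var 30))))
    (setVar 31 (.add (.var 27) (.add (.var 29) (.get 8 (.var 30)))))

/-- Overwrite the entry at the address in variable `31` unless it is at least as good. -/
def improveEntry : Program :=
  .branch (.and (.natLe (.lit 1) (.get 10 (.var 31)))
      (.realLe (.get 2 (.var 31)) (.add (.get 2 leftAddr) (.get 2 rightAddr))))
    .skip
    (.seq (.setNat 10 (.var 31) (.lit 1))
      (.seq (.setNat 11 (.var 31) (.var 29))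
        (.seq (.setNat 12 (.var 31) (.var 30))
          (.setReal 2 (.var 31) (.add (.get 2 leftAddr) (.get 2 rightAddr))))))

/-- Update the new table for the pair of the codes `x` and `y`. -/
def joinEntry : Program :=
  .branch (.and (.natLe (.lit 1) (.get 10 leftAddr)) (.natLe (.lit 1) (.get 10 rightAddr)))
    (.seq joinTarget improveEntry) .skip

/-- Join the parts, the last one first, to those of their parents. -/
def joinTables : Program :=
  forUp 22 (.sub (.var 0) (.lit 1))
    (.seq (.seq (setVar 28 (.sub (.sub (.var 0) (.lit 1)) (.var 22)))
        (.setNat 13 (.var 28) (.var 27)))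
      (.seq (forUp 29 (.var 21) (forUp 30 (.var 21) joinEntry))
        (.seq (.setNat 9 (.get 6 (.var 28)) (.var 27))
          (setVar 27 (.add (.var 27) (.var 21))))))

/-- The best affordable code of the whole tree in variable `33`. -/
def selectCode : Program :=
  forUp 29 (.var 21)
    (.branch (.and (.natLe (.lit 1) (.get 10 (.add (.get 9 (.lit 0)) (.var 29))))
        (.and (.realLe (.get 2 (.add (.get 9 (.lit 0)) (.var 29))) (.get 1 (.lit 0)))
          (.not (.and (.natLe (.lit 1) (.var 32)) (.natLe (.var 34) (.get 8 (.var 29)))))))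
      (.seq (setVar 32 (.lit 1)) (.seq (setVar 33 (.var 29)) (setVar 34 (.get 8 (.var 29)))))
      .skip)

/-- Trace back the codes of the single nodes in array `14`. -/
def traceBack : Program :=
  .seq (.setNat 14 (.lit 0) (.var 33))
    (forUp 22 (.sub (.var 0) (.lit 1))
      (.seq (setVar 28 (.add (.var 22) (.lit 1)))
        (.seq (setVar 31 (.add (.get 13 (.var 28)) (.get 14 (.get 6 (.var 28)))))
          (.seq (.setNat 14 (.get 6 (.var 28)) (.get 11 (.var 31)))
            (.setNat 14 (.var 28) (.get 12 (.var 31)))))))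

/-- Put out the chosen nodes. -/
def writeOutput : Program :=
  forUp 22 (.var 0) (.branch (.natLe (.get 14 (.var 22)) (.lit 0))
    (.setNat 2 (.get 5 (.var 22)) (.lit 1)) .skip)

/-- The program that solves budgeted MBC on trees. -/
def solveTree : Program :=
  .seq rowOffsets (.seq codeCount (.seq closeTable (.seq orderNodes (.seq initTables
    (.seq joinTables (.seq selectCode (.seq traceBack writeOutput)))))))

/-! ### Arithmetic tables without multiplication. -/

theorem rowOffsets_spec {n : ℕ} {M₀ : Memory} (hn : M₀.nat 0 0 = n) (h20 : M₀.nat 20 0 = 0) :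
    Tri rowOffsets M₀ (30 * n + 11) fun M => Same [3, 20, 22] [] M₀ M ∧
      M.nat 20 0 = n * n ∧ ∀ v < n, M.nat 3 v = v * n := by
  refine Tri.forUp (b := n) (T := 16) (fun k M => Same [3, 20, 22] [] M₀ M ∧ M.nat 22 0 = k ∧
    M.nat 20 0 = k * n ∧ ∀ v < k, M.nat 3 v = v * n) ?_ ?_ ?_ ?_ ?_
  · simp only [NatExp.time]
    omega
  · refine ⟨Same.refl.setNat (by decide) _ _, ?_⟩
    simp [Memory.setNat_nat, h20]
  · rintro k M ⟨hS, hk, -⟩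
    exact ⟨hk, (congrFun (hS.nat 0 (by decide)) 0).trans hn⟩
  · rintro k hk M ⟨hS, h22, h20, h3⟩
    have hn' : M.nat 0 0 = n := (congrFun (hS.nat 0 (by decide)) 0).trans hn
    refine Tri.exec ?_ ?_ ?_
    · simp [LoopFree]
    · decide
    · simp only [exec, NatExp.eval]
      refine ⟨by simp [Memory.setNat_nat, h22], ?_, ?_⟩
      · exact ((hS.setNat (by decide) _ _).setNat (by decide) _ _).setNat (by decide) _ _
      · simp [Memory.setNat_nat, Function.update_apply, h22, h20, hn']
        refine ⟨by ring, fun v hv => ?_⟩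
        split_ifs with h
        · rw [h]
        · exact h3 v (by omega)
  · rintro M ⟨hS, -, h20, h3⟩
    exact ⟨hS, h20, h3⟩

theorem codeCount_spec {n B : ℕ} {M₀ : Memory} (hn : M₀.nat 0 0 = n) (h20 : M₀.nat 20 0 = B)
    (h21 : M₀.nat 21 0 = 0) :
    Tri codeCount M₀ (40 * n + 40) fun M => Same [21, 22] [] M₀ M ∧
      M.nat 21 0 = (n + 1) * B := by
  refine Tri.forUp (b := n + 1) (T := 9) (fun k M => Same [21, 22] [] M₀ M ∧ M.nat 22 0 = k ∧
    M.nat 21 0 = k * B) ?_ ?_ ?_ ?_ ?_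
  · simp only [NatExp.time]
    omega
  · refine ⟨Same.refl.setNat (by decide) _ _, ?_⟩
    simp [Memory.setNat_nat, h21]
  · rintro k M ⟨hS, hk, -⟩
    refine ⟨hk, ?_⟩
    simp only [NatExp.eval, hS.nat 0 (by decide), hn]
  · rintro k hk M ⟨hS, h22, h21⟩
    have h20' : M.nat 20 0 = B := (congrFun (hS.nat 20 (by decide)) 0).trans h20
    refine Tri.exec ?_ ?_ ?_
    · simp [LoopFree]
    · decide
    · simp only [exec, NatExp.eval]
      refine ⟨by simp [Memory.setNat_nat, h22], ?_, ?_⟩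
      · exact (hS.setNat (by decide) _ _).setNat (by decide) _ _
      · simp [Memory.setNat_nat, h21, h20']
        ring
  · rintro M ⟨hS, -, h21⟩
    exact ⟨hS, h21⟩

theorem closeCode_of_lt {B y : ℕ} (h : y < B) : closeCode B y = y := by
  rw [closeCode, Nat.mod_eq_of_lt h, Nat.div_eq_of_lt h]
  simp

/-- Raising the open coordinate from `k` to `k + 1` adds `(k + 1) * k - k * (k - 1) = 2 * k` pairs.
This recursion fills the table by additions only. -/
theorem closeCode_of_le {B y : ℕ} (hB : 0 < B) (h : B ≤ y) :
    closeCode B y = closeCode B (y - B) + ((y - B) / B + (y - B) / B) := by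
  obtain ⟨z, rfl⟩ := Nat.exists_eq_add_of_le h
  rw [Nat.add_sub_cancel_left, closeCode, closeCode, Nat.add_mod_left, Nat.add_div_left _ hB]
  rcases z / B with _ | k
  · simp
  · simp only [Nat.add_sub_cancel]
    ring

theorem closeTable_spec {B N : ℕ} {M₀ : Memory} (hB : 0 < B) (h20 : M₀.nat 20 0 = B)
    (h21 : M₀.nat 21 0 = N) (h7 : ∀ y, M₀.nat 7 y = 0) :
    Tri closeTable M₀ (70 * N + 11) fun M => Same [7, 8, 22] [] M₀ M ∧
      ∀ y < N, M.nat 8 y = closeCode B y := by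
  refine Tri.forUp (b := N) (T := 56) (fun k M => Same [7, 8, 22] [] M₀ M ∧ M.nat 22 0 = k ∧
    (∀ y, k ≤ y → M.nat 7 y = 0) ∧ (∀ y < k, M.nat 7 y = y / B) ∧
    ∀ y < k, M.nat 8 y = closeCode B y) ?_ ?_ ?_ ?_ ?_
  · simp only [NatExp.time]
    omega
  · refine ⟨Same.refl.setNat (by decide) _ _, ?_⟩
    simp [Memory.setNat_nat, h7]
  · rintro k M ⟨hS, hk, -⟩
    exact ⟨hk, (congrFun (hS.nat 21 (by decide)) 0).trans h21⟩
  · rintro k hk M ⟨hS, h22, h70, h7, h8⟩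
    have h20' : M.nat 20 0 = B := (congrFun (hS.nat 20 (by decide)) 0).trans h20
    refine Tri.exec ?_ ?_ ?_
    · simp [LoopFree]
    · decide
    · simp only [exec, NatExp.eval, Cond.Holds, h20', h22]
      split_ifs with hBk
      · refine ⟨by simp [Memory.setNat_nat, h22], ?_, ?_⟩
        · exact ((hS.setNat (by decide) _ _).setNat (by decide) _ _).setNat (by decide) _ _
        · simp [Memory.setNat_nat, Function.update_apply, h22, h20']
          rw [h7 _ (by omega), h8 _ (by omega)]
          refine ⟨fun y hy => ?_, fun y hy => ?_, fun y hy => ?_⟩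
          · rw [if_neg (by omega)]
            exact h70 y (by omega)
          · split_ifs with h
            · obtain ⟨z, rfl⟩ := Nat.exists_eq_add_of_le hBk
              rw [h, Nat.add_sub_cancel_left, Nat.add_div_left _ hB]
            · exact h7 y (by omega)
          · split_ifs with h
            · rw [h, closeCode_of_le hB hBk]
            · exact h8 y (by omega)
      · refine ⟨by simp [Memory.setNat_nat, h22], ?_, ?_⟩
        · exact (hS.setNat (by decide) _ _).setNat (by decide) _ _
        · simp [Memory.setNat_nat, Function.update_apply]
          refine ⟨fun y hy => h70 y (by omega), fun y hy => ?_, fun y hy => ?_⟩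
          · rcases Nat.lt_or_ge y k with h | h
            · exact h7 y h
            · rw [h70 y h, Nat.div_eq_of_lt (by omega)]
          · split_ifs with h
            · rw [h, closeCode_of_lt (by omega)]
            · exact h8 y (by omega)
  · rintro M ⟨hS, -, -, -, h8⟩
    exact ⟨hS, h8⟩

/-! ### Building the search order. -/

/-- Node `w` is not yet in the order and adjacent to the node at position `j`. -/
def NewEdge (n : ℕ) (M : Memory) (j w : ℕ) : Prop :=
  w < n ∧ M.nat 4 w = 0 ∧ 1 ≤ M.nat 1 (M.nat 3 (M.nat 5 j) + w)

theorem findEdge_spec {n i : ℕ} {M₀ : Memory} (hn : M₀.nat 0 0 = n) (h22 : M₀.nat 22 0 = i) :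
    Tri findEdge M₀ ((i + 1) * (50 * n + 100) + 100) fun M => Same [23, 24, 25, 26] [] M₀ M ∧
      ((∃ j ≤ i, ∃ w, NewEdge n M₀ j w) →
        M.nat 26 0 ≤ i ∧ NewEdge n M₀ (M.nat 26 0) (M.nat 25 0)) := by
  refine Tri.forUp (b := i + 1) (T := n * 44 + 11) (fun k M => Same [23, 24, 25, 26] [] M₀ M ∧
    M.nat 23 0 = k ∧ ((∃ j < k, ∃ w, NewEdge n M₀ j w) →
      M.nat 26 0 ≤ i ∧ NewEdge n M₀ (M.nat 26 0) (M.nat 25 0))) ?_ ?_ ?_ ?_ ?_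
  · simp only [NatExp.time]
    nlinarith
  · refine ⟨Same.refl.setNat (by decide) _ _, ?_⟩
    simp [Memory.setNat_nat]
  · rintro k M ⟨hS, hk, -⟩
    refine ⟨hk, ?_⟩
    simp only [NatExp.eval, hS.nat 22 (by decide), h22]
  · rintro k hk M₁ ⟨hS₁, hk₁, hM₁⟩
    refine Tri.forUp (b := n) (T := 30) (fun l M => Same [23, 24, 25, 26] [] M₀ M ∧
      M.nat 24 0 = l ∧ M.nat 23 0 = k ∧
      (((∃ j < k, ∃ w, NewEdge n M₀ j w) ∨ ∃ w < l, NewEdge n M₀ k w) →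
        M.nat 26 0 ≤ i ∧ NewEdge n M₀ (M.nat 26 0) (M.nat 25 0))) ?_ ?_ ?_ ?_ ?_
    · simp only [NatExp.time]
      omega
    · refine ⟨hS₁.setNat (by decide) _ _, ?_⟩
      simpa [Memory.setNat_nat, hk₁] using hM₁
    · rintro l M ⟨hS, hl, -⟩
      exact ⟨hl, (congrFun (hS.nat 0 (by decide)) 0).trans hn⟩
    · rintro l hl M ⟨hS, hl', hk', hM⟩
      refine Tri.exec ?_ ?_ ?_
      · simp [LoopFree]
      · decide
      · simp only [exec, NatExp.eval, Cond.Holds, hl', hk', hS.nat 4 (by decide),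
          hS.nat 1 (by decide), hS.nat 3 (by decide), hS.nat 5 (by decide)]
        split_ifs with h
        · refine ⟨by simp [Memory.setNat_nat, hl'], ?_, ?_⟩
          · exact ((hS.setNat (by decide) _ _).setNat (by decide) _ _).setNat (by decide) _ _
          · simp [Memory.setNat_nat, hk']
            -- A later hit overwrites an earlier one; any new edge will do.
            exact fun _ => ⟨by omega, hl, by omega, h.2⟩
        · refine ⟨hl', hS.setNat (by decide) _ _, ?_⟩
          simp [Memory.setNat_nat, hk']
          rintro (h' | ⟨w, hw, h'⟩)
          · exact hM (Or.inl h')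
          · rcases Nat.lt_or_ge w l with hwl | hwl
            · exact hM (Or.inr ⟨w, hwl, h'⟩)
            · obtain rfl : w = l := by omega
              exact absurd ⟨h'.2.1.le, h'.2.2⟩ h
    · rintro M ⟨hS, -, hk', hM⟩
      refine ⟨hk', hS.setNat (by decide) _ _, ?_⟩
      simp [Memory.setNat_nat]
      rintro j hj w hw
      refine hM ?_
      rcases Nat.lt_or_ge j k with hjk | hjk
      · exact Or.inl ⟨j, hjk, w, hw⟩
      · obtain rfl : j = k := by omega
        exact Or.inr ⟨w, hw.1, hw⟩
  · rintro M ⟨hS, -, hM⟩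
    refine ⟨hS, ?_⟩
    rintro ⟨j, hj, hw⟩
    exact hM ⟨j, by omega, hw⟩

/-- The nodes at the positions `0, …, t` of array `5` form an initial segment of an order; array
`4` marks them. -/
structure Ordered {n : ℕ} (G : SimpleGraph (Fin n)) (t : ℕ) (M : Memory) : Prop where
  lt : ∀ j ≤ t, M.nat 5 j < n
  inj : ∀ j ≤ t, ∀ k ≤ t, M.nat 5 j = M.nat 5 k → j = k
  mark : ∀ v < n, M.nat 4 v = 0 ↔ ∀ j ≤ t, M.nat 5 j ≠ v
  par_lt : ∀ j, 0 < j → j ≤ t → M.nat 6 j < j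
  adj : ∀ j, 0 < j → j ≤ t → ∀ u v : Fin n, (u : ℕ) = M.nat 5 (M.nat 6 j) → (v : ℕ) = M.nat 5 j →
    G.Adj u v

/-- By counting, some node is not yet listed. A walk to it from the first listed node leaves the set
of listed nodes along some edge, which is new. -/
theorem Ordered.exists_newEdge {n t : ℕ} {G : SimpleGraph (Fin n)} {M : Memory}
    (h : Ordered G t M) (hG : G.Connected) (ht : t + 1 < n)
    (hadj : ∀ u v : Fin n, 1 ≤ M.nat 1 (u * n + v) ↔ G.Adj u v)
    (h3 : ∀ v < n, M.nat 3 v = v * n) : ∃ j ≤ t, ∃ w, NewEdge n M j w := by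
  have hex : ∃ v : Fin n, ∀ j ≤ t, M.nat 5 j ≠ v := by
    by_contra! hcon
    have hsub : (Finset.univ : Finset (Fin n)) ⊆ (Finset.range (t + 1)).attach.image
        fun j : {j // j ∈ Finset.range (t + 1)} =>
          (⟨M.nat 5 j, h.lt j (Nat.lt_succ_iff.1 (Finset.mem_range.1 j.2))⟩ : Fin n) := by
      intro v _
      obtain ⟨j, hj, hjv⟩ := hcon v
      exact Finset.mem_image.2 ⟨⟨j, Finset.mem_range.2 (Nat.lt_succ_iff.2 hj)⟩,
        Finset.mem_attach _ _, Fin.ext hjv⟩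
    have := (Finset.card_le_card hsub).trans Finset.card_image_le
    simp at this
    omega
  obtain ⟨v, hv⟩ := hex
  have h0 := h.lt 0 (Nat.zero_le t)
  obtain ⟨p⟩ := hG ⟨M.nat 5 0, h0⟩ v
  obtain ⟨d, -, ⟨j, hj, hjd⟩, hd⟩ := p.exists_boundary_dart
    {u | ∃ j ≤ t, M.nat 5 j = u} ⟨0, Nat.zero_le t, rfl⟩ (by
      rintro ⟨j, hj, hjv⟩
      exact hv j hj hjv)
  refine ⟨j, hj, d.snd, d.snd.2, ?_, ?_⟩
  · rw [h.mark _ d.snd.2]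
    exact fun j hj hjd => hd ⟨j, hj, hjd⟩
  · rw [hjd, h3 _ d.fst.2, hadj]
    exact d.adj

theorem orderNodes_spec {n : ℕ} {G : SimpleGraph (Fin n)} {M₀ : Memory} (hG : G.Connected)
    (hn : M₀.nat 0 0 = n) (hadj : ∀ u v : Fin n, 1 ≤ M₀.nat 1 (u * n + v) ↔ G.Adj u v)
    (h3 : ∀ v < n, M₀.nat 3 v = v * n) (h4 : ∀ v, M₀.nat 4 v = 0) (h5 : M₀.nat 5 0 = 0) :
    Tri orderNodes M₀ (3 + (n * (n * (50 * n + 100) + 200) + 100)) fun M =>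
      Same [4, 5, 6, 22, 23, 24, 25, 26] [] M₀ M ∧
      ∃ o : ℕ → Fin n, IsOrdering G o (M.nat 6) ∧ ∀ j < n, M.nat 5 j = o j := by
  have hn0 : 0 < n := by
    obtain ⟨v⟩ := hG.nonempty
    exact v.pos
  refine Tri.seq (Q := fun M => Same [4, 5, 6, 22, 23, 24, 25, 26] [] M₀ M ∧ Ordered G 0 M)
    (Tri.exec ?_ ?_ ?_) ?_
  · simp [LoopFree]
  · decide
  · refine ⟨Same.refl.setNat (by decide) _ _, ?_⟩
    simp only [exec, NatExp.eval]
    refine ⟨?_, ?_, ?_, ?_, ?_⟩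
    -- The order starts with node 0, which array `5` holds by default.
    · simpa [Memory.setNat_nat, h5] using hn0
    · intro j hj k hk _
      omega
    · simp [Memory.setNat_nat, Function.update_apply, h5, h4]
      intro v _
      rw [eq_comm]
    · intro j hj hj'
      omega
    · intro j hj hj'
      omega
  rintro M₁ ⟨hS₁, hM₁⟩
  refine Tri.forUp (b := n - 1) (T := n * (50 * n + 100) + 120)
    (fun t M => Same [4, 5, 6, 22, 23, 24, 25, 26] [] M₀ M ∧ M.nat 22 0 = t ∧ Ordered G t M)
    ?_ ?_ ?_ ?_ ?_
  · simp only [NatExp.time]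
    have : (n - 1) * (n * (50 * n + 100) + 120 + (1 + 1 + 1 + 1) + 12 + 1) ≤
        n * (n * (50 * n + 100) + 200) := Nat.mul_le_mul (Nat.sub_le _ _) (by omega)
    nlinarith
  · refine ⟨hS₁.setNat (by decide) _ _, by simp [Memory.setNat_nat], ?_⟩
    -- The loop counter is not among the arrays that `Ordered` reads, so its fields carry over by
    -- definition.
    obtain ⟨a1, a2, a3, a4, a5⟩ := hM₁
    exact ⟨a1, a2, a3, a4, a5⟩
  · rintro k M ⟨hS, hk, -⟩
    refine ⟨hk, ?_⟩
    simp only [NatExp.eval, hS.nat 0 (by decide), hn]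
  · rintro t ht M ⟨hS, ht', hM⟩
    have hn' : M.nat 0 0 = n := (congrFun (hS.nat 0 (by decide)) 0).trans hn
    have hadj' : ∀ u v : Fin n, 1 ≤ M.nat 1 (u * n + v) ↔ G.Adj u v := by
      rwa [hS.nat 1 (by decide)]
    have h3' : ∀ v < n, M.nat 3 v = v * n := by rwa [hS.nat 3 (by decide)]
    have hE := hM.exists_newEdge hG (by omega) hadj' h3'
    refine Tri.mono (Tri.seq (findEdge_spec hn' ht') (T' := 20) ?_) ?_ (fun _ h => h)
    · rintro M' ⟨hS', hM'⟩
      obtain ⟨hc, hw, hw4, hw1⟩ := hM' hE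
      refine Tri.exec ?_ ?_ ?_
      · simp [LoopFree]
      · decide
      · simp only [exec, NatExp.eval]
        have e22 : M'.nat 22 0 = t := (congrFun (hS'.nat 22 (by decide)) 0).trans ht'
        have e4 := hS'.nat 4 (by decide)
        have e5 := hS'.nat 5 (by decide)
        have e6 := hS'.nat 6 (by decide)
        refine ⟨by simp [Memory.setNat_nat, e22], ?_, by simp [Memory.setNat_nat], ?_⟩
        · exact (((hS.trans (hS'.weaken (by decide) (by decide))).setNat (by decide) _ _).setNat
            (by decide) _ _ |>.setNat (by decide) _ _).setNat (by decide) _ _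
        · obtain ⟨w, e25⟩ : ∃ w, M'.nat 25 0 = w := ⟨_, rfl⟩
          obtain ⟨c, e26⟩ : ∃ c, M'.nat 26 0 = c := ⟨_, rfl⟩
          rw [e25] at hw hw4 hw1
          rw [e26] at hc hw1
          have hnew : ∀ j ≤ t, M.nat 5 j ≠ w := (hM.mark w hw).1 hw4
          refine ⟨?_, ?_, ?_, ?_, ?_⟩
          · intro j hj
            simp [Memory.setNat_nat, Function.update_apply, e22, e5, e25]
            split_ifs with h
            · exact hw
            · exact hM.lt j (by omega)
          · intro j hj k hk
            simp [Memory.setNat_nat, Function.update_apply, e22, e5, e25]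
            split_ifs with h h' h'
            · omega
            · intro h''
              exact absurd h''.symm (hnew k (by omega))
            · intro h''
              exact absurd h'' (hnew j (by omega))
            · exact hM.inj j (by omega) k (by omega)
          · intro v hv
            simp [Memory.setNat_nat, Function.update_apply, e22, e5, e4, e25]
            have hmark := hM.mark v hv
            constructor
            · intro h j hj
              split_ifs at h ⊢ with h1 h2 h2
              · exact fun hwv => h2 hwv.symm
              · exact hmark.1 h j (by omega)
            · intro h
              rw [if_neg fun hvw => by simpa [hvw] using h (t + 1) le_rfl, hmark]
              intro j hj
              simpa [show j ≠ t + 1 by omega] using h j (by omega)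
          · intro j hj0 hj
            simp [Memory.setNat_nat, Function.update_apply, e22, e6, e26]
            split_ifs with h
            · omega
            · exact hM.par_lt j hj0 (by omega)
          · intro j hj0 hj u v
            simp [Memory.setNat_nat, Function.update_apply, e22, e6, e5, e25, e26]
            split_ifs with h1 h2 h2
            · omega
            · intro hu hv
              rw [← hadj', ← h3' u u.2, hu, hv]
              exact hw1
            · have := hM.par_lt j hj0 (by omega)
              omega
            · exact hM.adj j hj0 (by omega) u v
    · have : (t + 1) * (50 * n + 100) ≤ n * (50 * n + 100) :=
        Nat.mul_le_mul_right _ (by omega)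
      omega
  · rintro M ⟨hS, -, hM⟩
    -- Positions from `n` on are irrelevant and get the dummy node 0.
    refine ⟨hS, fun j => if h : M.nat 5 j < n then ⟨M.nat 5 j, h⟩ else ⟨0, hn0⟩, ?_, ?_⟩
    · refine ⟨?_, ?_, ?_⟩
      · intro j hj k hk
        rw [dif_pos (hM.lt j (by omega)), dif_pos (hM.lt k (by omega)), Fin.mk.injEq]
        exact hM.inj j (by omega) k (by omega)
      · exact fun j hj0 hj => hM.par_lt j hj0 (by omega)
      · intro j hj0 hj
        have := hM.par_lt j hj0 (by omega)
        rw [dif_pos (hM.lt j (by omega)), dif_pos (hM.lt _ (by omega))]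
        exact hM.adj j hj0 (by omega) _ _ rfl rfl
    · intro j hj
      simp only [dif_pos (hM.lt j (by omega))]

end Program

/-! ### The tables of the dynamic program in memory. -/

/-- The code `x` is present in the table of the part `j`, of length `N`. -/
def Present (N : ℕ) (M : Memory) (j x : ℕ) : Prop := x < N ∧ 1 ≤ M.nat 10 (M.nat 9 j + x)

/-- The cost of the code `x` in the table of the part `j`. -/
def costAt (M : Memory) (j x : ℕ) : ℝ := M.real 2 (M.nat 9 j + x)

/-- The code of the parent before the part `j` was joined to it. -/
def backLeft (M : Memory) (j z : ℕ) : ℕ := M.nat 11 (M.nat 13 j + z)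

/-- The code of the part `j` before it was joined to its parent. -/
def backRight (M : Memory) (j z : ℕ) : ℕ := M.nat 12 (M.nat 13 j + z)

/-- The tables after the joins of the parts `n - 1, …, i`, in memory. -/
structure Tables {n : ℕ} (I : Instance n) (o : ℕ → Fin n) (par : ℕ → ℕ) (i : ℕ) (M : Memory) :
    Prop where
  stage : ∃ A, Stage I o par i (Present ((n + 1) * (n * n)) M) (costAt M) (backLeft M)
    (backRight M) A
  table_le : ∀ j < n, M.nat 9 j + (n + 1) * (n * n) ≤ M.nat 27 0
  back_le : ∀ j, i ≤ j → j < n → M.nat 13 j + (n + 1) * (n * n) ≤ M.nat 27 0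
  fresh : ∀ a, M.nat 27 0 ≤ a → M.nat 10 a = 0

namespace Program

theorem initTables_spec {n : ℕ} {I : Instance n} {o : ℕ → Fin n} {M₀ : Memory}
    (ho : IsOrdering I.graph o (M₀.nat 6)) (hn : M₀.nat 0 0 = n) (h20 : M₀.nat 20 0 = n * n)
    (h21 : M₀.nat 21 0 = (n + 1) * (n * n)) (h5 : ∀ j < n, M₀.nat 5 j = o j)
    (hcost : ∀ v : Fin n, M₀.real 0 v = I.cost v)
    (h10 : ∀ a, M₀.nat 10 a = 0) (h2 : ∀ a, M₀.real 2 a = 0) :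
    Tri initTables M₀ (60 * n + 11) fun M => Same [9, 10, 22, 27] [2] M₀ M ∧
      Tables I o (M₀.nat 6) n M := by
  refine Tri.forUp (b := n) (T := 40) (fun k M => Same [9, 10, 22, 27] [2] M₀ M ∧
    M.nat 22 0 = k ∧
    (∀ j < k, M.nat 9 j + (n + 1) * (n * n) ≤ M.nat 27 0) ∧
    (∀ a, M.nat 27 0 ≤ a → M.nat 10 a = 0 ∧ M.real 2 a = 0) ∧
    ∀ j < k, (∀ x, Present ((n + 1) * (n * n)) M j x ↔ x = 0 ∨ x = n * n) ∧
      costAt M j 0 = I.cost (o j) ∧ costAt M j (n * n) = 0) ?_ ?_ ?_ ?_ ?_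
  · simp only [NatExp.time]
    omega
  · refine ⟨Same.refl.setNat (by decide) _ _, ?_⟩
    simp [Memory.setNat_nat, Memory.setNat_real, h10, h2]
  · rintro k M ⟨hS, hk, -⟩
    exact ⟨hk, (congrFun (hS.nat 0 (by decide)) 0).trans hn⟩
  · rintro k hk M ⟨hS, h22, h9, hf, ht⟩
    have e20 : M.nat 20 0 = n * n := (congrFun (hS.nat 20 (by decide)) 0).trans h20
    have e21 : M.nat 21 0 = (n + 1) * (n * n) := (congrFun (hS.nat 21 (by decide)) 0).trans h21
    have e5 : M.nat 5 k = o k := (congrFun (hS.nat 5 (by decide)) k).trans (h5 k hk)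
    have e0 : M.real 0 (o k) = I.cost (o k) :=
      (congrFun (hS.real 0 (by decide)) _).trans (hcost _)
    obtain ⟨τ, e27⟩ : ∃ τ, M.nat 27 0 = τ := ⟨_, rfl⟩
    rw [e27] at hf h9
    have hB : 0 < n * n := Nat.mul_pos (by omega) (by omega)
    have hBN : n * n < (n + 1) * (n * n) := by nlinarith
    -- With the products opaque, the address comparisons below are linear and within reach of
    -- `omega`.
    generalize (n + 1) * (n * n) = N at *
    generalize n * n = B at *
    refine Tri.exec ?_ ?_ ?_
    · simp [LoopFree]
    · decide
    · simp only [exec, NatExp.eval, RealExp.eval]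
      refine ⟨by simp [Memory.setNat_nat, Memory.setReal_nat, h22], ?_, ?_⟩
      · exact (((((hS.setNat (by decide) _ _).setNat (by decide) _ _).setReal (by decide) _
          _).setNat (by decide) _ _).setNat (by decide) _ _).setNat (by decide) _ _
      · simp [Memory.setNat_nat, Memory.setReal_nat, Memory.setNat_real, Memory.setReal_real, h22,
          e27, e20, e21, e5, e0, Present, costAt, Function.update_apply]
        refine ⟨?_, ?_, ?_⟩
        · intro j hj
          split_ifs with h
          · omega
          · have := h9 j (by omega)
            omega
        · intro a ha
          rw [if_neg (by omega), if_neg (by omega), if_neg (by omega)]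
          exact hf a (by omega)
        · intro j hj
          rcases eq_or_ne j k with rfl | hne
          · simp only [if_true, not_true_eq_false, false_imp_iff]
            simp only [Nat.add_left_cancel_iff, Nat.add_eq_left, hB.ne', if_false,
              (hf (τ + B) (by omega)).2, and_true]
            intro x
            rcases eq_or_ne x B with rfl | hxB
            · simpa using hBN
            · rw [if_neg hxB]
              rcases eq_or_ne x 0 with rfl | hx0
              · simpa using by omega
              · simp [hxB, hx0, (hf (τ + x) (by omega)).1]
          · obtain ⟨h1, h2, h3⟩ := ht j (by omega)
            have hj9 := h9 j (by omega)
            have e1 : M.nat 9 j ≠ τ := by omega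
            have e2 : M.nat 9 j + B ≠ τ := by omega
            simp only [hne, not_false_eq_true, true_imp_iff, if_false, e1, e2]
            refine ⟨fun x => ?_, h2, h3⟩
            rw [← h1, Present]
            refine and_congr_right fun hx => ?_
            rw [if_neg (by omega), if_neg (by omega)]
  · rintro M ⟨hS, -, h9, hf, ht⟩
    refine ⟨hS, ⟨_, Stage.init ho _ _ (fun j hj => (ht j hj).1) (fun j hj => (ht j hj).2.1)
      fun j hj => (ht j hj).2.2⟩, h9, fun j hj hj' => ?_, fun a ha => (hf a ha).1⟩
    omega

end Program

/-! ### Joining two tables. -/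

/-- The new table at address `τ` has been updated for the pairs of codes in `S`, starting from the
memory `M₀`. -/
structure Joined (N B τ p i : ℕ) (M₀ : Memory) (S : ℕ → ℕ → Prop) (M : Memory) : Prop where
  same : Same [10, 11, 12, 29, 30, 31] [2] M₀ M
  outside : ∀ a, a < τ ∨ τ + N ≤ a → M.nat 10 a = M₀.nat 10 a
  below : ∀ a < τ, M.nat 11 a = M₀.nat 11 a ∧ M.nat 12 a = M₀.nat 12 a ∧ M.real 2 a = M₀.real 2 a
  sound : ∀ z < N, 1 ≤ M.nat 10 (τ + z) → Present N M₀ p (M.nat 11 (τ + z)) ∧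
    Present N M₀ i (M.nat 12 (τ + z)) ∧
    mergeCode B (M.nat 11 (τ + z)) (M.nat 12 (τ + z)) = z ∧
    M.real 2 (τ + z) = costAt M₀ p (M.nat 11 (τ + z)) + costAt M₀ i (M.nat 12 (τ + z))
  complete : ∀ x y, S x y → Present N M₀ p x → Present N M₀ i y →
    1 ≤ M.nat 10 (τ + mergeCode B x y) ∧
    M.real 2 (τ + mergeCode B x y) ≤ costAt M₀ p x + costAt M₀ i y

theorem Joined.congr {N B τ p i : ℕ} {M₀ M M' : Memory} {S S' : ℕ → ℕ → Prop}
    (h : Joined N B τ p i M₀ S M) (hS : ∀ x y, x < N → y < N → S' x y → S x y)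
    (hM : Same [29, 30, 31] [] M M') : Joined N B τ p i M₀ S' M' := by
  obtain ⟨h1, h2, h3, h4, h5⟩ := h
  have e10 := hM.nat 10 (by decide)
  have e11 := hM.nat 11 (by decide)
  have e12 := hM.nat 12 (by decide)
  have e2 := hM.real 2 (by decide)
  refine ⟨h1.trans (hM.weaken (by decide) (by decide)), ?_, ?_, ?_, ?_⟩
  · rwa [e10]
  · rwa [e11, e12, e2]
  · rwa [e10, e11, e12, e2]
  · rw [e10, e2]
    exact fun x y hxy hx hy => h5 x y (hS x y hx.1 hy.1 hxy) hx hy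

namespace Program

/-- The entry is kept if it is present at cost at most `c` and replaced otherwise. Either way it
ends at most `c` and never gets dearer, so the pairs in `S` remain served. -/
theorem improveEntry_joined {N B τ p i x y : ℕ} {M₀ M : Memory} {S S' : ℕ → ℕ → Prop}
    (h28 : M.nat 28 0 = i) (h6 : M.nat 6 i = p)
    (hM : Joined N B τ p i M₀ S M) (h29 : M.nat 29 0 = x) (h30 : M.nat 30 0 = y)
    (h31 : M.nat 31 0 = τ + mergeCode B x y) (hpx : Present N M₀ p x) (hiy : Present N M₀ i y)
    (hlt : mergeCode B x y < N)
    (hl : M.real 2 (M.nat 9 p + x) = costAt M₀ p x)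
    (hr : M.real 2 (M.nat 9 i + y) = costAt M₀ i y)
    (hS : ∀ x' y', S' x' y' → S x' y' ∨ x' = x ∧ y' = y) :
    Joined N B τ p i M₀ S' (improveEntry.exec M) ∧ (improveEntry.exec M).nat 29 0 = x ∧
      (improveEntry.exec M).nat 30 0 = y := by
  set c := costAt M₀ p x + costAt M₀ i y with hc
  set m := mergeCode B x y with hm
  have hexec : improveEntry.exec M = if 1 ≤ M.nat 10 (τ + m) ∧ M.real 2 (τ + m) ≤ c then M else
      (((M.setNat 10 (τ + m) 1).setNat 11 (τ + m) x).setNat 12 (τ + m) y).setReal 2 (τ + m) c := by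
    simp [improveEntry, exec, Cond.Holds, NatExp.eval, RealExp.eval, leftAddr, rightAddr,
      Memory.setNat_nat, Memory.setNat_real, h28, h6, h29, h30, h31, hl, hr, hc]
  rw [hexec]
  obtain ⟨h1, h2, h3, h4, h5⟩ := hM
  split_ifs with h
  · refine ⟨⟨h1, h2, h3, h4, fun x' y' hxy hx' hy' => ?_⟩, h29, h30⟩
    rcases hS x' y' hxy with h' | ⟨rfl, rfl⟩
    · exact h5 x' y' h' hx' hy'
    · exact h
  · refine ⟨⟨?_, ?_, ?_, ?_, ?_⟩, ?_, ?_⟩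
    · exact (((h1.setNat (by decide) _ _).setNat (by decide) _ _).setNat (by decide) _
        _).setReal (by decide) _ _
    · intro a ha
      simp [Memory.setNat_nat, Memory.setReal_nat, Function.update_apply]
      rw [if_neg (by omega), h2 a ha]
    · intro a ha
      simp [Memory.setNat_nat, Memory.setReal_nat, Memory.setNat_real, Memory.setReal_real,
        show a ≠ τ + m by omega]
      exact h3 a ha
    · intro z hz
      simp [Memory.setNat_nat, Memory.setReal_nat, Memory.setNat_real, Memory.setReal_real,
        Function.update_apply]
      rcases eq_or_ne z m with rfl | hne
      · simp only [if_true]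
        exact fun _ => ⟨hpx, hiy, rfl, rfl⟩
      · simp only [hne, if_false]
        exact h4 z hz
    · intro x' y' hxy hx' hy'
      simp [Memory.setNat_nat, Memory.setReal_nat, Memory.setNat_real, Memory.setReal_real,
        Function.update_apply]
      rcases hS x' y' hxy with h' | ⟨rfl, rfl⟩
      · obtain ⟨h6, h7⟩ := h5 x' y' h' hx' hy'
        split_ifs with h8
        · rw [h8] at h6 h7
          refine ⟨le_rfl, le_trans ?_ h7⟩
          -- If the new cost exceeded the old one, the entry would not have been overwritten.
          by_contra hcon
          exact h ⟨h6, (not_le.1 hcon).le⟩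
        · exact ⟨h6, h7⟩
      · rw [← hm, if_pos rfl, if_pos rfl]
        exact ⟨le_rfl, le_rfl⟩
    · simp [Memory.setNat_nat, Memory.setReal_nat, h29]
    · simp [Memory.setNat_nat, Memory.setReal_nat, h30]

/-- Both old tables lie below `τ`, where nothing is written, so their entries still have the values
of `M₀`. Pairs with an absent code impose no condition. -/
theorem joinEntry_joined {N B τ p i x y : ℕ} {M₀ M : Memory} {S S' : ℕ → ℕ → Prop}
    (h20 : M₀.nat 20 0 = B) (h28 : M₀.nat 28 0 = i) (h6 : M₀.nat 6 i = p)
    (h27 : M₀.nat 27 0 = τ) (h8 : ∀ y < N, M₀.nat 8 y = closeCode B y)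
    (hp : M₀.nat 9 p + N ≤ τ) (hi : M₀.nat 9 i + N ≤ τ)
    (hlt : ∀ x y, Present N M₀ p x → Present N M₀ i y → mergeCode B x y < N)
    (hM : Joined N B τ p i M₀ S M) (h29 : M.nat 29 0 = x) (h30 : M.nat 30 0 = y)
    (hx : x < N) (hy : y < N) (hS : ∀ x' y', S' x' y' → S x' y' ∨ x' = x ∧ y' = y) :
    Joined N B τ p i M₀ S' (joinEntry.exec M) ∧ (joinEntry.exec M).nat 29 0 = x ∧
      (joinEntry.exec M).nat 30 0 = y := by
  have hsame := hM.same
  have hl : leftAddr.eval M = M₀.nat 9 p + x := by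
    simp only [leftAddr, NatExp.eval, hsame.nat 9 (by decide), hsame.nat 6 (by decide),
      hsame.nat 28 (by decide), h28, h6, h29]
  have hr : rightAddr.eval M = M₀.nat 9 i + y := by
    simp only [rightAddr, NatExp.eval, hsame.nat 9 (by decide), hsame.nat 28 (by decide), h28, h30]
  have hl10 : M.nat 10 (M₀.nat 9 p + x) = M₀.nat 10 (M₀.nat 9 p + x) :=
    hM.outside _ (Or.inl (by omega))
  have hr10 : M.nat 10 (M₀.nat 9 i + y) = M₀.nat 10 (M₀.nat 9 i + y) :=
    hM.outside _ (Or.inl (by omega))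
  have hl2 : M.real 2 (M₀.nat 9 p + x) = costAt M₀ p x := (hM.below _ (by omega)).2.2
  have hr2 : M.real 2 (M₀.nat 9 i + y) = costAt M₀ i y := (hM.below _ (by omega)).2.2
  rw [joinEntry, exec]
  simp only [Cond.Holds, NatExp.eval, hl, hr, hl10, hr10]
  split_ifs with hc
  · have hpx : Present N M₀ p x := ⟨hx, hc.1⟩
    have hiy : Present N M₀ i y := ⟨hy, hc.2⟩
    have hz := hlt x y hpx hiy
    have htarget : joinTarget.exec M = M.setNat 31 0 (τ + mergeCode B x y) := by
      simp only [joinTarget, exec, Cond.Holds, NatExp.eval, h29, h30, hsame.nat 20 (by decide),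
        hsame.nat 27 (by decide), hsame.nat 8 (by decide), h20, h27, h8 y hy, mergeCode]
      split_ifs with h1 h2 h2
      · omega
      · rfl
      · rfl
      · omega
    rw [exec, htarget]
    have hM' : Joined N B τ p i M₀ S (M.setNat 31 0 (τ + mergeCode B x y)) :=
      hM.congr (fun _ _ _ _ h => h) (Same.refl.setNat (by decide) _ _)
    refine improveEntry_joined ?_ ?_ hM' ?_ ?_ ?_ hpx hiy hz ?_ ?_ hS <;>
      simp [Memory.setNat_nat, Memory.setNat_real, hsame.nat 28 (by decide),
        hsame.nat 6 (by decide), hsame.nat 9 (by decide), h28, h6, h29, h30, hl2, hr2]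
  · obtain ⟨h1, h2, h3, h4, h5⟩ := hM
    refine ⟨⟨h1, h2, h3, h4, fun x' y' hxy hx' hy' => ?_⟩, h29, h30⟩
    rcases hS x' y' hxy with h' | ⟨rfl, rfl⟩
    · exact h5 x' y' h' hx' hy'
    · exact absurd ⟨hx'.2, hy'.2⟩ hc

theorem joinEntries_spec {N B τ p i : ℕ} {M₀ : Memory}
    (h20 : M₀.nat 20 0 = B) (h21 : M₀.nat 21 0 = N) (h28 : M₀.nat 28 0 = i)
    (h6 : M₀.nat 6 i = p) (h27 : M₀.nat 27 0 = τ) (h8 : ∀ y < N, M₀.nat 8 y = closeCode B y)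
    (hp : M₀.nat 9 p + N ≤ τ) (hi : M₀.nat 9 i + N ≤ τ)
    (hlt : ∀ x y, Present N M₀ p x → Present N M₀ i y → mergeCode B x y < N)
    (hfresh : ∀ a, τ ≤ a → M₀.nat 10 a = 0) :
    Tri (forUp 29 (.var 21) (forUp 30 (.var 21) joinEntry)) M₀ (N * (200 * N + 100) + 100)
      (Joined N B τ p i M₀ fun _ _ => True) := by
  refine Tri.forUp (b := N) (T := N * 200 + 20)
    (fun k M => Joined N B τ p i M₀ (fun x _ => x < k) M ∧ M.nat 29 0 = k) ?_ ?_ ?_ ?_ ?_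
  · simp only [NatExp.time]
    nlinarith
  · refine ⟨⟨Same.refl.setNat (by decide) _ _, ?_, ?_, ?_, ?_⟩, by simp [Memory.setNat_nat]⟩
    · simp [Memory.setNat_nat]
    · simp [Memory.setNat_nat, Memory.setNat_real]
    -- The new table starts out empty because its cells are fresh.
    · intro z _ hz1
      simp [Memory.setNat_nat, hfresh] at hz1
    · intro x y hx
      omega
  · rintro k M ⟨hM, hk⟩
    exact ⟨hk, (congrFun (hM.same.nat 21 (by decide)) 0).trans h21⟩
  · rintro k hk M₁ ⟨hM₁, hk₁⟩
    refine Tri.forUp (b := N) (T := 170)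
      (fun l M => Joined N B τ p i M₀ (fun x y => x < k ∨ x = k ∧ y < l) M ∧ M.nat 29 0 = k ∧
        M.nat 30 0 = l) ?_ ?_ ?_ ?_ ?_
    · simp only [NatExp.time]
      omega
    · refine ⟨hM₁.congr ?_ (Same.refl.setNat (by decide) _ _), ?_, ?_⟩
      · intro x y _ _ h
        omega
      · simp [Memory.setNat_nat, hk₁]
      · simp [Memory.setNat_nat]
    · rintro l M ⟨hM, -, hl⟩
      exact ⟨hl, (congrFun (hM.same.nat 21 (by decide)) 0).trans h21⟩
    · rintro l hl M ⟨hM, hk', hl'⟩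
      refine Tri.exec ?_ ?_ ?_
      · simp [LoopFree, joinEntry, joinTarget, improveEntry]
      · decide
      · obtain ⟨h1, h2, h3⟩ := joinEntry_joined (S' := fun x y => x < k ∨ x = k ∧ y < l + 1)
          h20 h28 h6 h27 h8 hp hi hlt hM hk' hl' hk hl (by omega)
        refine ⟨h3, h1.congr (fun _ _ _ _ h => h) (Same.refl.setNat (by decide) _ _), ?_, ?_⟩
        · simp [Memory.setNat_nat, h2]
        · simp [Memory.setNat_nat]
    · rintro M ⟨hM, hk', -⟩
      refine ⟨hk', hM.congr ?_ (Same.refl.setNat (by decide) _ _), by simp [Memory.setNat_nat]⟩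
      intro x y _ hy h
      omega
  · rintro M ⟨hM, -⟩
    exact hM.congr (fun x y hx _ _ => hx) Same.refl

end Program

/-- The new table lies above all earlier ones, so old entries and back pointers survive. Redirecting
the parent's address to `τ` makes it the table of the union, and `13` remembers `τ` for the trace
back. Then `Joined.sound` and `Joined.complete` are the hypotheses of `Stage.join`. -/
theorem Tables.join {n : ℕ} {I : Instance n} {o : ℕ → Fin n} {par : ℕ → ℕ} {i τ : ℕ}
    {M M₁ M₂ M₃ : Memory} (hG : I.graph.IsTree) (ho : IsOrdering I.graph o par)
    (hi : 0 < i) (hin : i < n) (hM : Tables I o par (i + 1) M) (hτ : M.nat 27 0 = τ)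
    (h9 : M₁.nat 9 = M.nat 9) (h10 : M₁.nat 10 = M.nat 10) (h11 : M₁.nat 11 = M.nat 11)
    (h12 : M₁.nat 12 = M.nat 12) (h13 : M₁.nat 13 = Function.update (M.nat 13) i τ)
    (h2 : M₁.real 2 = M.real 2)
    (hJ : Joined ((n + 1) * (n * n)) (n * n) τ (par i) i M₁ (fun _ _ => True) M₂)
    (h₃ : Same [9, 27] [] M₂ M₃) (h9₃ : M₃.nat 9 = Function.update (M₂.nat 9) (par i) τ)
    (h27 : M₃.nat 27 0 = τ + (n + 1) * (n * n)) : Tables I o par i M₃ := by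
  obtain ⟨⟨A, hA⟩, htab, hback, hfresh⟩ := hM
  rw [hτ] at htab hback hfresh
  have hp := ho.par_lt i hi hin
  have e9 : M₃.nat 9 = Function.update (M.nat 9) (par i) τ := by
    rw [h9₃, hJ.same.nat 9 (by decide), h9]
  have e13 : M₃.nat 13 = Function.update (M.nat 13) i τ := by
    rw [h₃.nat 13 (by decide), hJ.same.nat 13 (by decide), h13]
  have e10 := h₃.nat 10 (by decide)
  have e11 := h₃.nat 11 (by decide)
  have e12 := h₃.nat 12 (by decide)
  have e2 := h₃.real 2 (by decide)
  have hpres : ∀ j x, Present ((n + 1) * (n * n)) M₁ j x ↔ Present ((n + 1) * (n * n)) M j x := by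
    intro j x
    rw [Present, Present, h9, h10]
  have hcost : ∀ j x, costAt M₁ j x = costAt M j x := by
    intro j x
    rw [costAt, costAt, h9, h2]
  have hout := hJ.outside
  have hbelow := hJ.below
  have hsound := hJ.sound
  have hcomp := hJ.complete
  rw [h10] at hout
  rw [h11, h12, h2] at hbelow
  simp only [hpres, hcost] at hsound hcomp
  generalize hN : (n + 1) * (n * n) = N at *
  refine ⟨⟨_, hA.join hG ho hi hin ?_ ?_ ?_ ?_ ?_⟩, ?_, ?_, ?_⟩
  · intro j hj hjp x
    rw [hN, Present, Present, e10, e9, Function.update_of_ne hjp]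
    refine and_congr_right fun hx => ?_
    rw [hout _ (Or.inl _)]
    have := htab j (by omega)
    omega
  · intro j hj hjp x hx
    have := htab j (by omega)
    have := hx.1
    rw [costAt, costAt, e2, e9, Function.update_of_ne hjp, (hbelow _ (by omega)).2.2]
  · intro j hj hjn z hz
    have := hback j (by omega) hjn
    rw [backLeft, backLeft, backRight, backRight, e11, e12, e13, Function.update_of_ne hj.ne']
    exact ⟨(hbelow _ (by omega)).1, (hbelow _ (by omega)).2.1⟩
  · intro z hz
    rw [hN, Present, e10, e9, Function.update_self] at hz
    rw [hN, costAt, backLeft, backRight, e2, e9, e11, e12, e13, Function.update_self,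
      Function.update_self]
    exact ⟨hz.1, hsound z hz.1 hz.2⟩
  · intro x y hx hy
    have hlt := hA.mergeCode_lt hG ho hi hin hx hy
    rw [hN] at hlt
    rw [hN, Present, costAt, e10, e2, e9, Function.update_self]
    obtain ⟨h5, h6⟩ := hcomp x y trivial hx hy
    exact ⟨⟨hlt, h5⟩, h6⟩
  · intro j hj
    rw [hN, e9, h27, Function.update_apply]
    split_ifs
    · exact le_rfl
    · have := htab j hj
      omega
  · intro j hj hjn
    rw [hN, e13, h27, Function.update_apply]
    split_ifs
    · exact le_rfl
    · have := hback j (by omega) hjn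
      omega
  · intro a ha
    rw [h27] at ha
    rw [e10, hout a (Or.inr ha)]
    exact hfresh a (by omega)

namespace Program

theorem joinTables_spec {n : ℕ} {I : Instance n} {o : ℕ → Fin n} {par : ℕ → ℕ} {M₀ : Memory}
    (hG : I.graph.IsTree) (ho : IsOrdering I.graph o par) (hpar : M₀.nat 6 = par)
    (hn : M₀.nat 0 0 = n) (h20 : M₀.nat 20 0 = n * n) (h21 : M₀.nat 21 0 = (n + 1) * (n * n))
    (h8 : ∀ y < (n + 1) * (n * n), M₀.nat 8 y = closeCode (n * n) y)
    (hM₀ : Tables I o par n M₀) :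
    Tri joinTables M₀
      (n * ((n + 1) * (n * n) * (200 * ((n + 1) * (n * n)) + 100) + 200) + 100) fun M =>
      Same [9, 10, 11, 12, 13, 22, 27, 28, 29, 30, 31] [2] M₀ M ∧ Tables I o par 1 M := by
  refine Tri.forUp (b := n - 1)
    (T := (n + 1) * (n * n) * (200 * ((n + 1) * (n * n)) + 100) + 150)
    (fun t M => Same [9, 10, 11, 12, 13, 22, 27, 28, 29, 30, 31] [2] M₀ M ∧ M.nat 22 0 = t ∧
      Tables I o par (n - t) M) ?_ ?_ ?_ ?_ ?_
  · simp only [NatExp.time]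
    refine (Nat.add_le_add_right (Nat.add_le_add_right (Nat.mul_le_mul (Nat.sub_le n 1)
      (le_refl _)) _) _).trans ?_
    nlinarith
  · refine ⟨Same.refl.setNat (by decide) _ _, by simp [Memory.setNat_nat], ?_⟩
    obtain ⟨⟨A, hA⟩, h2, h3, h4⟩ := hM₀
    exact ⟨⟨A, hA⟩, h2, h3, h4⟩
  · rintro t M ⟨hS, ht, -⟩
    refine ⟨ht, ?_⟩
    simp only [NatExp.eval, hS.nat 0 (by decide), hn]
  · rintro t ht M ⟨hS, ht', hM⟩
    obtain ⟨i, hi⟩ : ∃ i, n - 1 - t = i := ⟨_, rfl⟩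
    have hi0 : 0 < i := by omega
    have hin : i < n := by omega
    rw [show n - t = i + 1 by omega] at hM
    have hM' := hM
    obtain ⟨⟨A, hA⟩, htab, hback, hfresh⟩ := hM'
    have hn' : M.nat 0 0 = n := (congrFun (hS.nat 0 (by decide)) 0).trans hn
    obtain ⟨τ, hτ⟩ : ∃ τ, M.nat 27 0 = τ := ⟨_, rfl⟩
    rw [hτ] at htab hfresh
    have hp := ho.par_lt i hi0 hin
    have e6 : M.nat 6 = par := (hS.nat 6 (by decide)).trans hpar
    have e8 := hS.nat 8 (by decide)
    have e20 : M.nat 20 0 = n * n := (congrFun (hS.nat 20 (by decide)) 0).trans h20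
    have e21 : M.nat 21 0 = (n + 1) * (n * n) := (congrFun (hS.nat 21 (by decide)) 0).trans h21
    refine Tri.mono (Tri.seq (T := 20) (T' := ((n + 1) * (n * n) *
        (200 * ((n + 1) * (n * n)) + 100) + 100) + 20)
      (Q := fun M₁ => M₁ = (M.setNat 28 0 i).setNat 13 i τ) (Tri.exec ?_ ?_ ?_) ?_) ?_
      (fun _ h => h)
    · simp [LoopFree]
    · decide
    · simp [exec, NatExp.eval, Memory.setNat_nat, hn', ht', hi, hτ]
    · rintro M₁ rfl
      refine Tri.seq (joinEntries_spec (N := (n + 1) * (n * n)) (B := n * n) (p := par i) (i := i)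
        (τ := τ) ?_ ?_ ?_ ?_ ?_ ?_ ?_ ?_ ?_ ?_) ?_
      · simpa [Memory.setNat_nat] using e20
      · simpa [Memory.setNat_nat] using e21
      · simp [Memory.setNat_nat]
      · simp [Memory.setNat_nat, e6]
      · simpa [Memory.setNat_nat] using hτ
      · simpa [Memory.setNat_nat, e8] using h8
      · simpa [Memory.setNat_nat] using htab (par i) (by omega)
      · simpa [Memory.setNat_nat] using htab i hin
      · intro x y hx hy
        refine hA.mergeCode_lt hG ho hi0 hin ?_ ?_
        · simpa [Present, Memory.setNat_nat] using hx
        · simpa [Present, Memory.setNat_nat] using hy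
      · simpa [Memory.setNat_nat] using hfresh
      · intro M₂ hJ
        have hS₂ := hJ.same
        have f28 : M₂.nat 28 0 = i := by
          rw [hS₂.nat 28 (by decide)]
          simp [Memory.setNat_nat]
        have f27 : M₂.nat 27 0 = τ := by
          rw [hS₂.nat 27 (by decide)]
          simpa [Memory.setNat_nat] using hτ
        have f21 : M₂.nat 21 0 = (n + 1) * (n * n) := by
          rw [hS₂.nat 21 (by decide)]
          simpa [Memory.setNat_nat] using e21
        have f6 : M₂.nat 6 = par := by
          rw [hS₂.nat 6 (by decide)]
          simpa [Memory.setNat_nat] using e6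
        have f22 : M₂.nat 22 0 = t := by
          rw [hS₂.nat 22 (by decide)]
          simpa [Memory.setNat_nat] using ht'
        refine Tri.exec ?_ ?_ ?_
        · simp [LoopFree]
        · decide
        · have hexec : ((setNat 9 (.get 6 (.var 28)) (.var 27)).seq
              (setVar 27 (.add (.var 27) (.var 21)))).exec M₂ =
              (M₂.setNat 9 (par i) τ).setNat 27 0 (τ + (n + 1) * (n * n)) := by
            simp [exec, NatExp.eval, Memory.setNat_nat, f28, f27, f21, f6]
          rw [hexec]
          have hS₃ : Same [9, 10, 11, 12, 13, 22, 27, 28, 29, 30, 31] [2] M₀ M₂ :=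
            ((hS.setNat (by decide) _ _).setNat (by decide) _ _).trans
              (hS₂.weaken (by decide) (by decide))
          refine ⟨by simp [Memory.setNat_nat, f22], ?_, by simp [Memory.setNat_nat], ?_⟩
          · exact ((hS₃.setNat (by decide) _ _).setNat (by decide) _ _).setNat (by decide) _ _
          · have hT : Tables I o par i
                ((M₂.setNat 9 (par i) τ).setNat 27 0 (τ + (n + 1) * (n * n))) := by
              refine hM.join hG ho hi0 hin hτ ?_ ?_ ?_ ?_ ?_ ?_ hJ
                ((Same.refl.setNat (by decide) _ _).setNat (by decide) _ _) ?_ ?_ <;>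
              simp [Memory.setNat_nat, Memory.setNat_real]
            rw [show n - (t + 1) = i by omega]
            obtain ⟨⟨A, hA⟩, h2, h3, h4⟩ := hT
            exact ⟨⟨A, hA⟩, h2, h3, h4⟩
    · omega
  · rintro M ⟨hS, -, hM⟩
    refine ⟨hS, ?_⟩
    -- Without `0 < n` the truncated difference below would be 0 instead of 1.
    have : 0 < n := (o 0).pos
    rwa [show n - (n - 1) = 1 by omega] at hM

/-! ### Selecting the best code, tracing back and output. -/

theorem selectCode_spec {N B : ℕ} {b : ℝ} {M₀ : Memory} (h21 : M₀.nat 21 0 = N)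
    (h8 : ∀ y < N, M₀.nat 8 y = closeCode B y) (hb : M₀.real 1 0 = b) (h32 : M₀.nat 32 0 = 0)
    (hex : ∃ x, Present N M₀ 0 x ∧ costAt M₀ 0 x ≤ b) :
    Tri selectCode M₀ (80 * N + 11) fun M => Same [29, 32, 33, 34] [] M₀ M ∧
      Present N M₀ 0 (M.nat 33 0) ∧ costAt M₀ 0 (M.nat 33 0) ≤ b ∧
      ∀ x, Present N M₀ 0 x → costAt M₀ 0 x ≤ b → closeCode B (M.nat 33 0) ≤ closeCode B x := by
  -- Variable `32` flags whether an affordable code has been met, and `34` holds the number of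
  -- joined pairs of the best one. At the end `hex` excludes an unset flag.
  refine Tri.forUp (b := N) (T := 60) (fun k M => Same [29, 32, 33, 34] [] M₀ M ∧
    M.nat 29 0 = k ∧
    (M.nat 32 0 = 0 → ∀ x < k, Present N M₀ 0 x → ¬ costAt M₀ 0 x ≤ b) ∧
    (M.nat 32 0 ≠ 0 → Present N M₀ 0 (M.nat 33 0) ∧ costAt M₀ 0 (M.nat 33 0) ≤ b ∧
      M.nat 34 0 = closeCode B (M.nat 33 0) ∧ ∀ x < k, Present N M₀ 0 x → costAt M₀ 0 x ≤ b →
        closeCode B (M.nat 33 0) ≤ closeCode B x)) ?_ ?_ ?_ ?_ ?_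
  · simp only [NatExp.time]
    omega
  · refine ⟨Same.refl.setNat (by decide) _ _, ?_⟩
    simp [Memory.setNat_nat, h32]
  · rintro k M ⟨hS, hk, -⟩
    exact ⟨hk, (congrFun (hS.nat 21 (by decide)) 0).trans h21⟩
  · rintro k hk M ⟨hS, h29, hno, hyes⟩
    refine Tri.exec ?_ ?_ ?_
    · simp [LoopFree]
    · decide
    · simp only [exec, NatExp.eval, RealExp.eval, Cond.Holds, h29, hS.nat 10 (by decide),
        hS.nat 9 (by decide), hS.nat 8 (by decide), hS.real 2 (by decide), hS.real 1 (by decide),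
        hb, h8 k hk]
      split_ifs with h
      · obtain ⟨h1, h2, h3⟩ := h
        refine ⟨by simp [Memory.setNat_nat, h29], ?_, ?_⟩
        · exact (((hS.setNat (by decide) _ _).setNat (by decide) _ _).setNat (by decide) _
            _).setNat (by decide) _ _
        · simp [Memory.setNat_nat, h29, hS.nat 8 (by decide), h8 k hk]
          refine ⟨⟨hk, h1⟩, h2, fun x hx hxp hxb => ?_⟩
          rcases Nat.lt_or_ge x k with hxk | hxk
          · rcases Nat.eq_zero_or_pos (M.nat 32 0) with h0 | h0
            · exact absurd hxb (hno h0 x hxk hxp)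
            · obtain ⟨-, -, h4, h5⟩ := hyes h0.ne'
              have h6 := h5 x hxk hxp hxb
              have h7 : ¬ M.nat 34 0 ≤ closeCode B k := fun h7 => h3 ⟨h0, h7⟩
              omega
          · rw [show x = k by omega]
      · refine ⟨h29, hS.setNat (by decide) _ _, ?_⟩
        simp [Memory.setNat_nat]
        refine ⟨fun h0 x hx hxp => ?_, fun h0 => ?_⟩
        · rcases Nat.lt_or_ge x k with hxk | hxk
          · exact not_le.1 (hno h0 x hxk hxp)
          · obtain rfl : x = k := by omega
            by_contra! hcon
            exact h ⟨hxp.2, hcon, fun h' => by omega⟩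
        · obtain ⟨h1, h2, h3, h4⟩ := hyes h0
          refine ⟨h1, h2, h3, fun x hx hxp hxb => ?_⟩
          rcases Nat.lt_or_ge x k with hxk | hxk
          · exact h4 x hxk hxp hxb
          · obtain rfl : x = k := by omega
            by_contra! hcon
            exact h ⟨hxp.2, hxb, fun h' => by omega⟩
  · rintro M ⟨hS, -, hno, hyes⟩
    obtain ⟨x, hx, hxb⟩ := hex
    rcases eq_or_ne (M.nat 32 0) 0 with h0 | h0
    · exact absurd hxb (hno h0 x hx.1 hx)
    · obtain ⟨h1, h2, -, h4⟩ := hyes h0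
      exact ⟨hS, h1, h2, fun x hx => h4 x hx.1 hx⟩

theorem traceBack_spec {n : ℕ} {M₀ : Memory} (hn : M₀.nat 0 0 = n)
    (hpar : ∀ j, 0 < j → j < n → M₀.nat 6 j < j) :
    Tri traceBack M₀ (80 * n + 40) fun M => Same [14, 22, 28, 31] [] M₀ M ∧
      ∃ cur : ℕ → ℕ, cur 0 = M₀.nat 33 0 ∧
        M.nat 14 = trace (M₀.nat 6) (backLeft M₀) (backRight M₀) (n - 1) 1 cur := by
  refine Tri.mono (Tri.seq (T := 10) (T' := 80 * n + 20)
    (Q := fun M => M = M₀.setNat 14 0 (M₀.nat 33 0)) (Tri.exec ?_ ?_ rfl) ?_) (by omega)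
    (fun _ h => h)
  · simp [LoopFree]
  · decide
  rintro _ rfl
  -- Invariant: undoing the remaining joins from the present contents of array `14` gives the result
  -- of the full trace.
  refine Tri.forUp (b := n - 1) (T := 60) (fun k M => Same [14, 22, 28, 31] [] M₀ M ∧
    M.nat 22 0 = k ∧ ∃ cur : ℕ → ℕ, cur 0 = M₀.nat 33 0 ∧
      trace (M₀.nat 6) (backLeft M₀) (backRight M₀) (n - 1 - k) (k + 1) (M.nat 14) =
        trace (M₀.nat 6) (backLeft M₀) (backRight M₀) (n - 1) 1 cur) ?_ ?_ ?_ ?_ ?_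
  · simp only [NatExp.time]
    omega
  · refine ⟨(Same.refl.setNat (by decide) _ _).setNat (by decide) _ _, ?_⟩
    simp only [Memory.setNat_nat]
    exact ⟨by simp, _, by simp, rfl⟩
  · rintro k M ⟨hS, hk, -⟩
    refine ⟨hk, ?_⟩
    simp only [NatExp.eval, hS.nat 0 (by decide), hn]
  · rintro k hk M ⟨hS, h22, cur, hcur, htr⟩
    have hlt := hpar (k + 1) (by omega) (by omega)
    have e6 := hS.nat 6 (by decide)
    have e11 := hS.nat 11 (by decide)
    have e12 := hS.nat 12 (by decide)
    have e13 := hS.nat 13 (by decide)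
    refine Tri.exec ?_ ?_ ?_
    · simp [LoopFree]
    · decide
    · simp only [exec, NatExp.eval]
      refine ⟨by simp [Memory.setNat_nat, h22], ?_, by simp [Memory.setNat_nat], cur, hcur, ?_⟩
      · exact ((((hS.setNat (by decide) _ _).setNat (by decide) _ _).setNat (by decide) _
          _).setNat (by decide) _ _).setNat (by decide) _ _
      · rw [← htr, show n - 1 - k = (n - 1 - (k + 1)) + 1 by omega, trace]
        congr 1
        simp [Memory.setNat_nat, traceStep, backLeft, backRight, h22, e6, e11, e12, e13]
  · rintro M ⟨hS, -, cur, hcur, htr⟩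
    refine ⟨hS, cur, hcur, ?_⟩
    rwa [Nat.sub_self, trace] at htr

theorem writeOutput_spec {n : ℕ} {o : ℕ → Fin n} {M₀ : Memory} (hn : M₀.nat 0 0 = n)
    (h5 : ∀ j < n, M₀.nat 5 j = o j) (h2 : ∀ v, M₀.nat 2 v = 0) :
    Tri writeOutput M₀ (50 * n + 11) fun M => M.output n = chosen o (M₀.nat 14) := by
  refine Tri.forUp (b := n) (T := 30) (fun k M => Same [2, 22] [] M₀ M ∧ M.nat 22 0 = k ∧
    ∀ v : Fin n, M.nat 2 v ≠ 0 ↔ ∃ j < k, M₀.nat 14 j = 0 ∧ o j = v) ?_ ?_ ?_ ?_ ?_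
  · simp only [NatExp.time]
    omega
  · refine ⟨Same.refl.setNat (by decide) _ _, ?_⟩
    simp [Memory.setNat_nat, h2]
  · rintro k M ⟨hS, hk, -⟩
    exact ⟨hk, (congrFun (hS.nat 0 (by decide)) 0).trans hn⟩
  · rintro k hk M ⟨hS, h22, hM⟩
    refine Tri.exec ?_ ?_ ?_
    · simp [LoopFree]
    · decide
    · simp only [exec, NatExp.eval, Cond.Holds, h22, hS.nat 14 (by decide), hS.nat 5 (by decide),
        h5 k hk]
      split_ifs with h
      · refine ⟨by simp [Memory.setNat_nat, h22], ?_, by simp [Memory.setNat_nat], fun v => ?_⟩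
        · exact (hS.setNat (by decide) _ _).setNat (by decide) _ _
        · simp only [Memory.setNat_nat]
          rcases eq_or_ne v (o k) with rfl | hv
          · simpa using ⟨k, by omega, by omega, rfl⟩
          · have hv' : (v : ℕ) ≠ o k := fun h => hv (Fin.ext h)
            rw [if_neg (by decide), if_true, Function.update_of_ne hv', hM]
            constructor
            · rintro ⟨j, hj, h'⟩
              exact ⟨j, by omega, h'⟩
            · rintro ⟨j, hj, h', hjv⟩
              refine ⟨j, ?_, h', hjv⟩
              have : j ≠ k := fun hjk => hv (hjk ▸ hjv.symm)
              omega
      · refine ⟨h22, hS.setNat (by decide) _ _, by simp [Memory.setNat_nat], fun v => ?_⟩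
        simp only [Memory.setNat_nat]
        rw [if_neg (by decide), hM]
        constructor
        · rintro ⟨j, hj, h'⟩
          exact ⟨j, by omega, h'⟩
        · rintro ⟨j, hj, h', hjv⟩
          refine ⟨j, ?_, h', hjv⟩
          have : j ≠ k := by
            rintro rfl
            exact h h'.le
          omega
  · rintro M ⟨-, -, hM⟩
    ext v
    rw [Memory.output, Finset.mem_filter, hM v]
    simp [chosen, and_assoc]

end Program

/-! ### Reading the instance from the initial memory. -/

theorem index_inj {n : ℕ} {u v u' v' : Fin n} (h : (u : ℕ) * n + v = u' * n + v') :
    u = u' ∧ v = v' := by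
  have hn : 0 < n := u.pos
  have h1 := congrArg (· / n) h
  have h2 := congrArg (· % n) h
  simp only [mul_comm _ n, Nat.mul_add_div hn, Nat.mul_add_mod, Nat.div_eq_of_lt v.2,
    Nat.div_eq_of_lt v'.2, Nat.mod_eq_of_lt v.2, Nat.mod_eq_of_lt v'.2, add_zero] at h1 h2
  exact ⟨Fin.ext h1, Fin.ext h2⟩

namespace Instance

variable {n : ℕ} (I : Instance n)

theorem load_size : I.load.nat 0 0 = n := by simp [load]

theorem load_adj (u v : Fin n) : 1 ≤ I.load.nat 1 (u * n + v) ↔ I.graph.Adj u v := by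
  have h : (∃ u' v' : Fin n, I.graph.Adj u' v' ∧ (u : ℕ) * n + v = u' * n + v') ↔
      I.graph.Adj u v := by
    constructor
    · rintro ⟨u', v', hadj, h⟩
      obtain ⟨rfl, rfl⟩ := index_inj h
      exact hadj
    · exact fun hadj => ⟨u, v, hadj, rfl⟩
  simp only [load, one_ne_zero, false_and, if_false]
  split_ifs with hadj
  · exact iff_of_true le_rfl (h.1 hadj.2)
  · exact iff_of_false (by simp) fun h' => hadj ⟨rfl, h.2 h'⟩

theorem load_nat {a : ℕ} (ha : 2 ≤ a) (k : ℕ) : I.load.nat a k = 0 := by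
  simp [load, show a ≠ 0 by omega, show a ≠ 1 by omega]

theorem load_cost (v : Fin n) : I.load.real 0 v = I.cost v := by simp [load]

theorem load_budget : I.load.real 1 0 = I.budget := by simp [load]

theorem load_real {a : ℕ} (ha : 2 ≤ a) (k : ℕ) : I.load.real a k = 0 := by
  simp [load, show a ≠ 0 by omega, show a ≠ 1 by omega]

end Instance

/-! ### Correctness and running time of the whole program. -/

namespace Program

/-- A bound on the number of steps of `solveTree`, where `N` is the number of codes. -/
def timeBound (n N : ℕ) : ℕ :=
  (30 * n + 11) + ((40 * n + 40) + ((70 * N + 11) +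
    ((3 + (n * (n * (50 * n + 100) + 200) + 100)) + ((60 * n + 11) +
      ((n * (N * (200 * N + 100) + 200) + 100) + ((80 * N + 11) + ((80 * n + 40) +
        (50 * n + 11))))))))

theorem solveTree_spec {n : ℕ} (I : Instance n) (hG : I.graph.IsTree) :
    SolvesWithin solveTree I (timeBound n ((n + 1) * (n * n))) := by
  suffices h : Tri solveTree I.load (timeBound n ((n + 1) * (n * n)))
      fun M => I.IsOptimal (M.output n) by
    obtain ⟨t, M, h1, h2, h3⟩ := h
    exact ⟨t, M, h1, h2, h3⟩
  have hn0 : 0 < n := by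
    obtain ⟨v⟩ := hG.connected.nonempty
    exact v.pos
  refine Tri.seq (rowOffsets_spec I.load_size (I.load_nat (by decide) _)) ?_
  rintro M₁ ⟨hS₁, h20, h3⟩
  have z₁ : ∀ a, 2 ≤ a → a ∉ [3, 20, 22] → ∀ k, M₁.nat a k = 0 := fun a ha ha' k => by
    rw [hS₁.nat a ha', I.load_nat ha]
  refine Tri.seq (codeCount_spec (n := n) (B := n * n) ?_ h20 (z₁ 21 (by decide) (by decide) 0)) ?_
  · rw [hS₁.nat 0 (by decide), I.load_size]
  rintro M₂ ⟨hS₂, h21⟩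
  have hS₂' : Same [3, 20, 21, 22] [] I.load M₂ :=
    (hS₁.weaken (by decide) (by decide)).trans (hS₂.weaken (by decide) (by decide))
  refine Tri.seq (closeTable_spec (B := n * n) (N := (n + 1) * (n * n)) (by positivity) ?_ h21
    fun y => ?_) ?_
  · rw [hS₂.nat 20 (by decide), h20]
  · rw [hS₂'.nat 7 (by decide), I.load_nat (by decide)]
  rintro M₃ ⟨hS₃, h8⟩
  have hS₃' : Same [3, 7, 8, 20, 21, 22] [] I.load M₃ :=
    (hS₂'.weaken (by decide) (by decide)).trans (hS₃.weaken (by decide) (by decide))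
  refine Tri.seq (orderNodes_spec (n := n) (G := I.graph) hG.connected ?_ ?_ ?_ ?_ ?_) ?_
  · rw [hS₃'.nat 0 (by decide), I.load_size]
  · rw [hS₃'.nat 1 (by decide)]
    exact I.load_adj
  · rwa [hS₃.nat 3 (by decide), hS₂.nat 3 (by decide)]
  · intro v
    rw [hS₃'.nat 4 (by decide), I.load_nat (by decide)]
  · rw [hS₃'.nat 5 (by decide), I.load_nat (by decide)]
  rintro M₄ ⟨hS₄, o, ho, h5⟩
  have hS₄' : Same [3, 4, 5, 6, 7, 8, 20, 21, 22, 23, 24, 25, 26] [] I.load M₄ :=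
    (hS₃'.weaken (by decide) (by decide)).trans (hS₄.weaken (by decide) (by decide))
  have g0 : M₄.nat 0 0 = n := by rw [hS₄'.nat 0 (by decide), I.load_size]
  have g20 : M₄.nat 20 0 = n * n := by
    rw [hS₄.nat 20 (by decide), hS₃.nat 20 (by decide), hS₂.nat 20 (by decide), h20]
  have g21 : M₄.nat 21 0 = (n + 1) * (n * n) := by
    rw [hS₄.nat 21 (by decide), hS₃.nat 21 (by decide), h21]
  have g8 : ∀ y < (n + 1) * (n * n), M₄.nat 8 y = closeCode (n * n) y := by
    rwa [hS₄.nat 8 (by decide)]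
  refine Tri.seq (initTables_spec (I := I) ho g0 g20 g21 h5 ?_ ?_ ?_) ?_
  · rw [hS₄'.real 0 (by decide)]
    exact I.load_cost
  · intro a
    rw [hS₄'.nat 10 (by decide), I.load_nat (by decide)]
  · intro a
    rw [hS₄'.real 2 (by decide), I.load_real (by decide)]
  rintro M₅ ⟨hS₅, hT₅⟩
  refine Tri.seq (joinTables_spec hG ho (hS₅.nat 6 (by decide)) ?_ ?_ ?_ ?_ hT₅) ?_
  · rw [hS₅.nat 0 (by decide), g0]
  · rw [hS₅.nat 20 (by decide), g20]
  · rw [hS₅.nat 21 (by decide), g21]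
  · rwa [hS₅.nat 8 (by decide)]
  rintro M₆ ⟨hS₆, hT₆⟩
  have hS₆' : Same [9, 10, 11, 12, 13, 22, 27, 28, 29, 30, 31] [2] M₄ M₆ :=
    (hS₅.weaken (by decide) (by decide)).trans hS₆
  obtain ⟨A, hA⟩ := hT₆.stage
  refine Tri.seq (selectCode_spec (N := (n + 1) * (n * n)) (B := n * n) (b := I.budget)
    ?_ ?_ ?_ ?_ hA.exists_feasible) ?_
  · rw [hS₆'.nat 21 (by decide), g21]
  · rwa [hS₆'.nat 8 (by decide)]
  · rw [hS₆'.real 1 (by decide), hS₄'.real 1 (by decide), I.load_budget]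
  · rw [hS₆'.nat 32 (by decide), hS₄'.nat 32 (by decide), I.load_nat (by decide)]
  rintro M₇ ⟨hS₇, hp, hb, hmin⟩
  have g6 : M₇.nat 6 = M₄.nat 6 := by rw [hS₇.nat 6 (by decide), hS₆'.nat 6 (by decide)]
  refine Tri.seq (traceBack_spec (n := n) ?_ ?_) ?_
  · rw [hS₇.nat 0 (by decide), hS₆'.nat 0 (by decide), g0]
  · rw [g6]
    exact ho.par_lt
  rintro M₈ ⟨hS₈, cur, hcur, htr⟩
  refine Tri.mono (writeOutput_spec (o := o) ?_ ?_ ?_) le_rfl ?_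
  · rw [hS₈.nat 0 (by decide), hS₇.nat 0 (by decide), hS₆'.nat 0 (by decide), g0]
  · rwa [hS₈.nat 5 (by decide), hS₇.nat 5 (by decide), hS₆'.nat 5 (by decide)]
  · intro v
    rw [hS₈.nat 2 (by decide), hS₇.nat 2 (by decide), hS₆'.nat 2 (by decide),
      hS₄'.nat 2 (by decide), I.load_nat (by decide)]
  · intro M hM
    rw [hM, htr, g6]
    refine hA.isOptimal hG ?_ ?_ ?_ fun j _ _ z _ => ?_
    · rwa [hcur]
    · rwa [hcur]
    · rwa [hcur]
    · rw [backLeft, backRight, backLeft, backRight, hS₇.nat 11 (by decide),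
        hS₇.nat 12 (by decide), hS₇.nat 13 (by decide)]
      exact ⟨rfl, rfl⟩

/-- With `N ≤ 2 * n ^ 3` the leading term `200 * n * N ^ 2` becomes `800 * n ^ 7`. Raising the lower
powers of `n` to the seventh brings the coefficients to 2448 in total. -/
theorem timeBound_le {n : ℕ} (hn : 0 < n) :
    timeBound n ((n + 1) * (n * n)) ≤ 2500 * n ^ 7 := by
  have hN : (n + 1) * (n * n) ≤ 2 * n ^ 3 := by
    nlinarith [Nat.mul_le_mul_right (n * n) hn]
  have h1 : timeBound n ((n + 1) * (n * n)) ≤ timeBound n (2 * n ^ 3) := by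
    unfold timeBound
    gcongr
  refine h1.trans ?_
  have p : ∀ k ≤ 7, n ^ k ≤ n ^ 7 := fun k hk => Nat.pow_le_pow_right hn hk
  have h2 : timeBound n (2 * n ^ 3) =
      800 * n ^ 7 + 200 * n ^ 4 + 50 * n ^ 3 + 100 * n ^ 2 + 660 * n ^ 1 + 300 * n ^ 3 +
        338 * n ^ 0 := by
    unfold timeBound
    ring
  have := p 0 (by decide)
  have := p 1 (by decide)
  have := p 2 (by decide)
  have := p 3 (by decide)
  have := p 4 (by decide)
  omega

end Program

end MBC

theorem mainTheorem4 :
    ∃ P : MBC.Program,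
      (∃ p : Polynomial ℕ, ∀ (n : ℕ) (I : MBC.Instance n), I.graph.IsTree →
        MBC.SolvesWithin P I (p.eval n)) ∧
      (∃ K : ℕ, ∀ (n : ℕ) (I : MBC.Instance n), I.graph.IsTree → MBC.IsBinary I.graph →
        MBC.SolvesWithin P I (K * n ^ 7)) := by
  have key : ∀ (n : ℕ) (I : MBC.Instance n), I.graph.IsTree →
      MBC.SolvesWithin MBC.Program.solveTree I (2500 * n ^ 7) := by
    intro n I hG
    obtain ⟨t, M, hr, ht, hM⟩ := MBC.Program.solveTree_spec I hG
    have hn : 0 < n := by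
      obtain ⟨v⟩ := hG.connected.nonempty
      exact v.pos
    exact ⟨t, M, hr, ht.trans (MBC.Program.timeBound_le hn), hM⟩
  refine ⟨MBC.Program.solveTree, ⟨2500 * Polynomial.X ^ 7, fun n I hG => ?_⟩, 2500,
    fun n I hG _ => key n I hG⟩
  simpa using key n I hG
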